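/- Let $d\ge 2$, $\lambda>0$, and let $S$ be a homogeneous Poisson process of rate $\lambda$ on $\mathbb R^{d-1}\times\mathbb R$. Let $B(x)\subset\mathbb R^{d-1}$ be the closed Euclidean unit ball centred at $x$, and let $\mathcal S_{d-1}$ be the set of locally finite subsets (configurations) of $\mathbb R^{d-1}$, with the $\sigma$-algebra generated by the numbers of points in Borel sets. A walk started at $(x,r)$ stays at $x$ until the first time $r'>r$ such that $(x',r')\in S$ for some $x'$ with $x\in B(x')$; at time $r'$ it jumps to $x'$, and it continues from $(x',r')$ in the same way. For $\eta\in\mathcal S_{d-1}$ and $t\ge 0$ let $\eta^{\eta}_t$ be the set of positions at time $t$ of all walks started from the points $(x,0)$, $x\in\eta$, and from the points $(x,r)\in S$ with $0\le r\le t$. Let $\eta_0$ be the set of positions at time $0$ of all walks started from the points $(x,r)\in S$ with $r\le 0$. Put $P_tf(\eta)=\mathbb E[f(\eta^\eta_t)]$ and $E[f]=\mathbb E[f(\eta_0)]$. A function $f:\mathcal S_{d-1}\to\mathbb R$ has finite support if there is a bounded set $\Lambda\subset\mathbb R^{d-1}$ such that $f(\eta)$ depends only on $\eta\cap\Lambda$.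 Then $\{P_t: t\ge 0\}$ is the semigroup associated to the generator $$Lf(\eta)=\lambda\int_{\mathbb R^{d-1}}\big[f\big((\eta\setminus B(u))\cup\{u\}\big)-f(\eta)\big]\,du ,$$ that is, for bounded measurable $f$ of finite support, $P_tf$ is again such a function, $P_0f=f$, $P_{s+t}f=P_sP_tf$ for $s,t\ge 0$, and $h^{-1}(P_hf-f)\to Lf$ uniformly on $\mathcal S_{d-1}$ as $h\downarrow 0$. The law of $\eta_0$ is the unique probability measure on $\mathcal S_{d-1}$ that is invariant for $\{P_t\}$ (i.e. under which $P_tf$ and $f$ have the same expectation for all such $f$ and all $t\ge0$). Moreover, the system converges exponentially fast to this invariant measure: there is a constant $C_d>0$ depending only on $d$ and, for every bounded measurable $f:\mathcal S_{d-1}\to\mathbb R$ of finite support, a finite constant $C(f)$ depending only on $f$ and $d$, such that $$\big\|P_tf-E[f]\big\|_\infty=\sup_{\eta\in\mathcal S_{d-1}}\big|P_tf(\eta)-E[f]\big|\le C(f)\,e^{-C_d\lambda t}\qquad\text{for every } t\ge 0 .$$ -/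

import Mathlib

open MeasureTheory ProbabilityTheory Filter Topology Bornology
open scoped NNReal

namespace PoissonTree

/-- Locally finite (unlabelled) configurations of points of `X`: subsets that meet every bounded
set in finitely many points. -/
def Conf (X : Type*) [PseudoMetricSpace X] : Type _ :=
  {η : Set X // ∀ K : Set X, IsBounded K → (η ∩ K).Finite}

/-- The usual σ-algebra on configurations, generated by the numbers of points in Borel sets. -/
noncomputable instance Conf.instMeasurableSpace (X : Type*) [PseudoMetricSpace X] [MeasurableSpace X] :
    MeasurableSpace (Conf X) :=
  ⨆ (A : Set X) (_ : MeasurableSet A),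
    MeasurableSpace.comap (fun η : Conf X => (η.1 ∩ A).encard) ⊤

open Classical in
/-- A locally finite set, regarded as a configuration (a set that is not locally finite is sent
to the empty configuration). -/
noncomputable def Conf.ofSet {X : Type*} [PseudoMetricSpace X] (s : Set X) : Conf X :=
  if h : ∀ K : Set X, IsBounded K → (s ∩ K).Finite then ⟨s, h⟩
  else ⟨∅, fun K _ => by simp⟩

/-- `S` is a homogeneous Poisson process of rate `lam` on `X`, defined on `(Ω, P)`: the numbers of
points in bounded Borel sets are Poisson distributed with mean `lam` times the volume, and the
numbers of points in disjoint bounded Borel sets are independent. -/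
structure IsPoissonProcess {X : Type*} [PseudoMetricSpace X] [MeasureSpace X]
    {Ω : Type*} [MeasurableSpace Ω] (lam : ℝ) (S : Ω → Conf X) (P : Measure Ω) : Prop where
  measurable : Measurable S
  law_count : ∀ A : Set X, MeasurableSet A → IsBounded A →
    P.map (fun ω => ((S ω).1 ∩ A).ncard)
      = poissonMeasure (Real.toNNReal lam * (volume A).toNNReal)
  indep_count : ∀ (k : ℕ) (A : Fin k → Set X), (∀ i, MeasurableSet (A i)) →
    (∀ i, IsBounded (A i)) → Pairwise (fun i j => Disjoint (A i) (A j)) →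
    iIndepFun (fun (i : Fin k) (ω : Ω) => ((S ω).1 ∩ A i).ncard) P

/-- The space `ℝ^(d-1)`, with the Euclidean norm. A point `s = (x, r)` of `Space d × ℝ` has the
space coordinate `s.1 = x` and the time coordinate `s.2 = r`. -/
abbrev Space (d : ℕ) : Type := EuclideanSpace ℝ (Fin (d - 1))

/-- The times at which the ray `{(x, t) : t > r}` emitted by `s = (x, r)` meets an obstacle
`B(x') × {r'}`, `(x', r') ∈ S`, where `B(x')` is the closed unit ball centred at `x'`. -/
def hitTimes {d : ℕ} (S : Set (Space d × ℝ)) (s : Space d × ℝ) : Set ℝ :=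
  {t | s.2 < t ∧ ∃ x' : Space d, (x', t) ∈ S ∧ s.1 ∈ Metric.closedBall x' 1}

/-- `s'` is a mother of `s`: the centre of the first obstacle met by the ray emitted by `s`. -/
def IsMother {d : ℕ} (S : Set (Space d × ℝ)) (s s' : Space d × ℝ) : Prop :=
  s' ∈ S ∧ s.1 ∈ Metric.closedBall s'.1 1 ∧ IsLeast (hitTimes S s) s'.2

open Classical in
/-- The mother `α(s, S)` of `s` (and `s` itself if the ray meets no obstacle). -/
noncomputable def mother {d : ℕ} (S : Set (Space d × ℝ)) (s : Space d × ℝ) : Space d × ℝ :=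
  if h : ∃ s', IsMother S s s' then h.choose else s

/-- `X^s_t = y`: the walk started at `s = (x, r)` is at `y` at time `t ≥ r`. This means that for
some `n` the `n`-th ancestor `α^n(s)` has space coordinate `y`, its time coordinate (the time of
the `n`-th jump) is at most `t`, and the next obstacle is met only after time `t`. -/
def WalkAt {d : ℕ} (S : Set (Space d × ℝ)) (s : Space d × ℝ) (t : ℝ) (y : Space d) : Prop :=
  ∃ n : ℕ, ((mother S)^[n] s).1 = y ∧ ((mother S)^[n] s).2 ≤ t ∧
    ∀ u ∈ hitTimes S ((mother S)^[n] s), t < u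

/-- The set `η^{η,t'}_t` of positions at time `t` of the walks started from the points of `S`
with time coordinate in `[t', t]` and from the points of `η` at time `t'`. -/
def processFrom {d : ℕ} (S : Set (Space d × ℝ)) (η : Set (Space d)) (t' t : ℝ) :
    Set (Space d) :=
  {y | ∃ s : Space d × ℝ, ((s ∈ S ∧ t' ≤ s.2 ∧ s.2 ≤ t) ∨ (s.1 ∈ η ∧ s.2 = t')) ∧
    WalkAt S s t y}

/-- The set `η_t` of positions at time `t` of all walks started from points of `S` with time
coordinate at most `t`. -/
def processAt {d : ℕ} (S : Set (Space d × ℝ)) (t : ℝ) : Set (Space d) :=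
  {y | ∃ s ∈ S, s.2 ≤ t ∧ WalkAt S s t y}

/-- `P_t f (η) = 𝔼 [f (η^{η,0}_t)]`. -/
noncomputable def semigroup {d : ℕ} {Ω : Type*} [MeasurableSpace Ω] (P : Measure Ω)
    (S : Ω → Conf (Space d × ℝ)) (t : ℝ) (f : Conf (Space d) → ℝ) (η : Conf (Space d)) : ℝ :=
  ∫ ω, f (Conf.ofSet (processFrom (S ω).1 η.1 0 t)) ∂P

/-- The law of `η_0`. -/
noncomputable def stationaryState {d : ℕ} {Ω : Type*} [MeasurableSpace Ω] (P : Measure Ω)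
    (S : Ω → Conf (Space d × ℝ)) : Measure (Conf (Space d)) :=
  P.map (fun ω => Conf.ofSet (processAt (S ω).1 0))

/-- Bounded (measurable) functions of finite support, that is, functions that depend on the
configuration only through its points in some bounded region. -/
structure IsBoundedLocal {d : ℕ} (f : Conf (Space d) → ℝ) : Prop where
  measurable : Measurable f
  bounded : ∃ M : ℝ, ∀ η, |f η| ≤ M
  finite_support : ∃ Λ : Set (Space d), IsBounded Λ ∧
    ∀ η ξ : Conf (Space d), η.1 ∩ Λ = ξ.1 ∩ Λ → f η = f ξ

/-- The configuration `(η \ B(u)) ∪ {u}`. -/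
noncomputable def update {d : ℕ} (η : Conf (Space d)) (u : Space d) : Conf (Space d) :=
  ⟨(η.1 \ Metric.closedBall u 1) ∪ {u}, fun K hK =>
    ((η.2 K hK).union (Set.finite_singleton u)).subset (by
      rintro y ⟨hy | hy, hyK⟩
      · exact Or.inl ⟨hy.1, hyK⟩
      · exact Or.inr hy)⟩

/-- The generator `L f (η) = lam * ∫ [f ((η \ B(u)) ∪ {u}) - f η] du`. -/
noncomputable def generator {d : ℕ} (lam : ℝ) (f : Conf (Space d) → ℝ) (η : Conf (Space d)) : ℝ :=
  lam * ∫ u : Space d, (f (update η u) - f η)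

/-- `(T t)`, `t ≥ 0`, is a semigroup of operators on the bounded functions of finite support whose
derivative at time zero, in the supremum norm, is `L`. -/
structure IsSemigroupWithGenerator {d : ℕ}
    (T : ℝ → (Conf (Space d) → ℝ) → (Conf (Space d) → ℝ))
    (L : (Conf (Space d) → ℝ) → (Conf (Space d) → ℝ)) : Prop where
  maps_to : ∀ f, IsBoundedLocal f → ∀ t, 0 ≤ t → IsBoundedLocal (T t f)
  zero : ∀ f, IsBoundedLocal f → T 0 f = f
  add : ∀ f, IsBoundedLocal f → ∀ s t, 0 ≤ s → 0 ≤ t → T (s + t) f = T s (T t f)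
  deriv : ∀ f, IsBoundedLocal f →
    TendstoUniformly (fun (h : ℝ) (η : Conf (Space d)) => (T h f η - f η) / h) (L f) (𝓝[>] 0)

/-- `μ` is a stationary (invariant) probability measure for `(T t)`, `t ≥ 0`. -/
structure IsStationary {d : ℕ} (T : ℝ → (Conf (Space d) → ℝ) → (Conf (Space d) → ℝ))
    (μ : Measure (Conf (Space d))) : Prop where
  isProbabilityMeasure : IsProbabilityMeasure μ
  invariant : ∀ f, IsBoundedLocal f → ∀ t, 0 ≤ t → ∫ η, T t f η ∂μ = ∫ η, f η ∂μ

end PoissonTree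

/-! After a jump a walk sits at a point of `S`, and that point starts a walk of its own. Hence a
site is occupied at time `t` exactly when it belongs to the initial configuration or to `S` and no
obstacle has covered it since it appeared (`mem_processFrom`, `mem_processAt`). Iterated mothers
play no further role.

Once `y` has been covered during `(0, t]`, its occupation no longer depends on the initial
configuration and agrees with that of the process started in the infinite past
(`mem_evolve_iff_mem_processAt`). Cover the support of `f` by finitely many balls of radius 1/2. An
obstacle centred in such a ball covers the whole ball, so the entire support is covered except with
probability at most (number of balls) * exp(-v * lam * t), where v is the volume of a ball of radius
1/2. Off that event the two processes agree on the support, which gives the exponential bound with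
rate constant v (`HasPoissonVoids.abs_semigroup_sub_le`). Invariance and uniqueness follow from this
convergence, the former together with the semigroup property.

The semigroup property comes from continuing the process after time `s` with an independent copy of
the noise (`evolve_concat`, `HasPoissonVoids.concat`). Equality of laws rests on Rényi's principle
that void probabilities determine the law of a configuration (`Conf.measure_ext`). Independence of
counts enters only for the generator: during `(0, h]` the bounded region that can influence the
support receives no point, or one uniformly placed point, which acts as `update`, or at least two
points, with probability O(h^2) (`IsPoissonProcess.abs_semigroup_sub_generator_le`). -/

namespace PoissonTree

/-! ### Configurations: void events, Rényi's principle and measurability of counts -/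

section Configurations

variable {X : Type*} [MetricSpace X]

lemma Conf.finite_inter (η : Conf X) {K : Set X} (hK : IsBounded K) : (η.1 ∩ K).Finite :=
  η.2 K hK

lemma exists_mesh_separating (F : Finset X) :
    ∃ n₀ : ℕ, ∀ n ≥ n₀, ∀ x ∈ F, ∀ y ∈ F, dist x y < 2 / ((n : ℝ) + 1) → x = y := by
  have key : ∀ p ∈ F ×ˢ F, ∃ n₀ : ℕ, ∀ n ≥ n₀, dist p.1 p.2 < 2 / ((n : ℝ) + 1) → p.1 = p.2 := by
    rintro ⟨x, y⟩ -
    by_cases hxy : x = y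
    · exact ⟨0, fun _ _ _ => hxy⟩
    · have h0 : 0 < dist x y := dist_pos.2 hxy
      obtain ⟨N, hN⟩ := exists_nat_gt (2 / dist x y)
      refine ⟨N, fun n hn h => absurd h (not_lt.2 ?_)⟩
      rw [div_le_iff₀ (by positivity)]
      rw [div_lt_iff₀ h0] at hN
      have : (N : ℝ) ≤ n := by exact_mod_cast hn
      nlinarith
  choose! N hN using key
  refine ⟨(F ×ˢ F).sup N, fun n hn x hx y hy => ?_⟩
  have hp : (x, y) ∈ F ×ˢ F := Finset.mem_product.2 ⟨hx, hy⟩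
  exact hN (x, y) hp n ((Finset.le_sup hp).trans hn)

lemma Conf.ofSet_val {s : Set X} (h : ∀ K : Set X, IsBounded K → (s ∩ K).Finite) :
    (Conf.ofSet s).1 = s :=
  congrArg Subtype.val (dif_pos h : Conf.ofSet s = ⟨s, h⟩)

lemma Conf.countable [Nonempty X] (η : Conf X) : η.1.Countable := by
  obtain ⟨x⟩ := ‹Nonempty X›
  have : η.1 = ⋃ n : ℕ, η.1 ∩ Metric.closedBall x n := by
    rw [← Set.inter_iUnion, Metric.iUnion_closedBall_nat, Set.inter_univ]
  rw [this]
  exact Set.countable_iUnion fun n => (η.finite_inter Metric.isBounded_closedBall).countable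

section Mesh

variable [SecondCountableTopology X] [Nonempty X]

/-- A countable Borel partition of the space into cells of diameter at most `2 / (n + 1)`. -/
noncomputable def meshCell (X : Type*) [MetricSpace X] [SecondCountableTopology X] [Nonempty X]
    (n i : ℕ) : Set X :=
  disjointed (fun i => Metric.ball (TopologicalSpace.denseSeq X i) (1 / ((n : ℝ) + 1))) i

lemma exists_mem_meshCell (n : ℕ) (x : X) : ∃ i, x ∈ meshCell X n i := by
  have : x ∈ ⋃ i, meshCell X n i := by
    unfold meshCell
    rw [iUnion_disjointed, Set.mem_iUnion]
    obtain ⟨i, hi⟩ := Metric.denseRange_iff.1 (TopologicalSpace.denseRange_denseSeq X) x _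
      (show (0 : ℝ) < 1 / ((n : ℝ) + 1) by positivity)
    exact ⟨i, hi⟩
  simpa using this

lemma dist_lt_of_mem_meshCell {n i : ℕ} {x y : X} (hx : x ∈ meshCell X n i)
    (hy : y ∈ meshCell X n i) : dist x y < 2 / ((n : ℝ) + 1) := by
  have hx' := disjointed_subset _ _ hx
  have hy' := disjointed_subset _ _ hy
  rw [Metric.mem_ball] at hx' hy'
  calc dist x y ≤ dist x (TopologicalSpace.denseSeq X i) + dist y (TopologicalSpace.denseSeq X i) :=
        dist_triangle_right _ _ _
    _ < 1 / ((n : ℝ) + 1) + 1 / ((n : ℝ) + 1) := add_lt_add hx' hy'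
    _ = 2 / ((n : ℝ) + 1) := by ring

/-- Finitely many points fall into different cells once the mesh is fine, and distinct cells are
disjoint. The right-hand side has only countable quantifiers over occupation of bounded sets, so
counts become expressible through void events; the same `n` serves as fineness and as truncation
radius. -/
lemma le_encard_iff_meshCell (x₀ : X) (η : Set X) (A : Set X) (m : ℕ) :
    (m : ℕ∞) ≤ (η ∩ A).encard ↔ ∃ n : ℕ, ∃ I : Finset ℕ, I.card = m ∧
      ∀ i ∈ I, (η ∩ (A ∩ Metric.closedBall x₀ n ∩ meshCell X n i)).Nonempty := by
  classical
  constructor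
  · intro h
    obtain ⟨t, ht, htm⟩ := Set.exists_subset_encard_eq h
    have htf : t.Finite := Set.finite_of_encard_eq_coe htm
    lift t to Finset X using htf
    rw [Set.encard_coe_eq_coe_finsetCard] at htm
    have htm : t.card = m := by exact_mod_cast htm
    obtain ⟨n₀, hn₀⟩ := exists_mesh_separating t
    obtain ⟨R, hR⟩ := (t.finite_toSet.isBounded).subset_closedBall x₀
    obtain ⟨n₁, hn₁⟩ := exists_nat_ge R
    set n := max n₀ n₁
    choose c hc using exists_mem_meshCell (X := X) n
    refine ⟨n, t.image c, ?_, ?_⟩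
    · rw [Finset.card_image_of_injOn, htm]
      intro x hx y hy hxy
      refine hn₀ n (le_max_left _ _) x hx y hy (dist_lt_of_mem_meshCell (hc x) ?_)
      rw [hxy]
      exact hc y
    · intro i hi
      obtain ⟨x, hx, rfl⟩ := Finset.mem_image.1 hi
      refine ⟨x, (ht hx).1, ⟨(ht hx).2, ?_⟩, hc x⟩
      refine Metric.closedBall_subset_closedBall (hn₁.trans ?_) (hR hx)
      exact_mod_cast le_max_right _ _
  · rintro ⟨n, I, rfl, hI⟩
    choose! p hp using hI
    have hinj : Set.InjOn p I := by
      intro i hi j hj hij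
      by_contra hne
      have hd : Disjoint (meshCell X n i) (meshCell X n j) := disjoint_disjointed _ hne
      refine Set.disjoint_left.1 hd (hp i hi).2.2 ?_
      rw [hij]
      exact (hp j hj).2.2
    rw [← Finset.card_image_of_injOn hinj, ← Set.encard_coe_eq_coe_finsetCard]
    refine Set.encard_le_encard ?_
    intro x hx
    obtain ⟨i, hi, rfl⟩ := Finset.mem_image.1 (Finset.mem_coe.1 hx)
    exact ⟨(hp i hi).1, (hp i hi).2.1.1⟩

end Mesh

variable [MeasurableSpace X]

lemma Conf.measurable_encard {A : Set X} (hA : MeasurableSet A) :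
    Measurable (fun η : Conf X => (η.1 ∩ A).encard) := by
  rw [measurable_iff_comap_le]
  exact le_iSup₂ (f := fun (A : Set X) (_ : MeasurableSet A) =>
    MeasurableSpace.comap (fun η : Conf X => (η.1 ∩ A).encard) ⊤) A hA

/-- The events that a configuration has no point in a given bounded Borel set. -/
def voidEvents (X : Type*) [MetricSpace X] [MeasurableSpace X] : Set (Set (Conf X)) :=
  {E | ∃ A : Set X, MeasurableSet A ∧ IsBounded A ∧ E = {η | η.1 ∩ A = ∅}}

lemma isPiSystem_voidEvents : IsPiSystem (voidEvents X) := by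
  rintro _ ⟨A, hA, hA', rfl⟩ _ ⟨B, hB, hB', rfl⟩ -
  refine ⟨A ∪ B, hA.union hB, hA'.union hB', ?_⟩
  ext η
  simp [Set.inter_union_distrib_left]

lemma Conf.measurableSet_void {A : Set X} (hA : MeasurableSet A) :
    MeasurableSet {η : Conf X | η.1 ∩ A = ∅} := by
  have := Conf.measurable_encard hA (measurableSet_singleton 0)
  convert this using 1
  ext η
  simp

variable [BorelSpace X] [SecondCountableTopology X] [Nonempty X]

lemma Conf.measurableSet (η : Conf X) : MeasurableSet η.1 := η.countable.measurableSet

lemma measurableSet_meshCell (n i : ℕ) : MeasurableSet (meshCell X n i) :=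
  MeasurableSet.disjointed (fun _ => Metric.isOpen_ball.measurableSet) i

/-- The σ-algebra on configurations is generated by the void events. -/
lemma Conf.measurableSpace_eq_generateFrom_void :
    Conf.instMeasurableSpace X = MeasurableSpace.generateFrom (voidEvents X) := by
  apply le_antisymm
  · obtain ⟨x₀⟩ := ‹Nonempty X›
    refine iSup₂_le fun A hA => ?_
    rw [← measurable_iff_comap_le]
    let : MeasurableSpace (Conf X) := MeasurableSpace.generateFrom (voidEvents X)
    have hle : ∀ m : ℕ, MeasurableSet {η : Conf X | (m : ℕ∞) ≤ (η.1 ∩ A).encard} := by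
      intro m
      simp only [le_encard_iff_meshCell x₀, Set.ofPred_exists, Set.ofPred_and, Set.ofPred_forall]
      refine MeasurableSet.iUnion fun n => MeasurableSet.iUnion fun I =>
        (MeasurableSet.const _).inter (MeasurableSet.iInter fun i => MeasurableSet.iInter fun _ => ?_)
      have : MeasurableSet {η : Conf X |
          η.1 ∩ (A ∩ Metric.closedBall x₀ n ∩ meshCell X n i) = ∅} :=
        MeasurableSpace.measurableSet_generateFrom ⟨_, (hA.inter
          Metric.isClosed_closedBall.measurableSet).inter (measurableSet_meshCell n i),
          Metric.isBounded_closedBall.subset (fun x hx => hx.1.2), rfl⟩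
      convert this.compl using 1
      ext η
      simp [Set.nonempty_iff_ne_empty]
    refine ENat.measurable_iff.2 fun n => ?_
    have : (fun η : Conf X => (η.1 ∩ A).encard) ⁻¹' {(n : ℕ∞)}
        = {η : Conf X | (n : ℕ∞) ≤ (η.1 ∩ A).encard} \
          {η : Conf X | ((n + 1 : ℕ) : ℕ∞) ≤ (η.1 ∩ A).encard} := by
      ext η
      simp only [Set.mem_preimage, Set.mem_singleton_iff, Set.mem_sdiff, Set.mem_ofPred_eq, not_le]
      rw [Nat.cast_add, Nat.cast_one, ENat.lt_add_one_iff (ENat.natCast_ne_top n), le_antisymm_iff,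
        and_comm]
    rw [this]
    exact (hle n).diff (hle (n + 1))
  · refine MeasurableSpace.generateFrom_le ?_
    rintro _ ⟨A, hA, -, rfl⟩
    exact Conf.measurableSet_void hA

lemma Conf.measurable_of_void {α : Type*} [MeasurableSpace α] {g : α → Conf X}
    (h : ∀ A : Set X, MeasurableSet A → IsBounded A → MeasurableSet {a | (g a).1 ∩ A = ∅}) :
    Measurable g := by
  rw [Conf.measurableSpace_eq_generateFrom_void (X := X)]
  refine measurable_generateFrom ?_
  rintro _ ⟨A, hA, hA', rfl⟩
  exact h A hA hA'

/-- Rényi's principle: the void events form a generating π-system, because avoiding two sets means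
avoiding their union. -/
lemma Conf.measure_ext {μ ν : Measure (Conf X)} [IsProbabilityMeasure μ] [IsProbabilityMeasure ν]
    (h : ∀ A : Set X, MeasurableSet A → IsBounded A →
      μ {η | η.1 ∩ A = ∅} = ν {η | η.1 ∩ A = ∅}) : μ = ν := by
  refine ext_of_generate_finite (voidEvents X) Conf.measurableSpace_eq_generateFrom_void
    isPiSystem_voidEvents ?_ (by simp)
  rintro _ ⟨A, hA, hA', rfl⟩
  exact h A hA hA'

/-- The counting measure of a configuration, as a kernel. -/
noncomputable def countKernel (X : Type*) [MetricSpace X] [MeasurableSpace X] [BorelSpace X]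
    [SecondCountableTopology X] [Nonempty X] : Kernel (Conf X) X where
  toFun η := Measure.count.restrict η.1
  measurable' := by
    refine Measure.measurable_of_measurable_coe _ fun A hA => ?_
    have : (fun η : Conf X => Measure.count.restrict η.1 A)
        = fun η : Conf X => (((η.1 ∩ A).encard : ℕ∞) : ENNReal) := by
      funext η
      rw [Measure.restrict_apply hA, Measure.count_apply (hA.inter η.measurableSet), Set.inter_comm]
    rw [this]
    exact (measurable_of_countable _).comp (Conf.measurable_encard hA)

lemma countKernel_apply (η : Conf X) {A : Set X} (hA : MeasurableSet A) :
    countKernel X η A = ((η.1 ∩ A).encard : ENNReal) := by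
  change Measure.count.restrict η.1 A = _
  rw [Measure.restrict_apply hA, Measure.count_apply (hA.inter η.measurableSet), Set.inter_comm]

-- Needed for the measurability of sections. Total counts may be infinite, so the kernel is cut
-- along the shells `D k` and then according to the number `j` of points in the shell; each piece
-- has mass at most `j`.
open Classical in
instance : IsSFiniteKernel (countKernel X) := by
  obtain ⟨x₀⟩ := ‹Nonempty X›
  set D : ℕ → Set X := disjointed fun n : ℕ => Metric.closedBall x₀ n with hD
  have hDm : ∀ k, MeasurableSet (D k) :=
    MeasurableSet.disjointed fun _ => Metric.isClosed_closedBall.measurableSet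
  have hDd : Pairwise (fun i j => Disjoint (D i) (D j)) := disjoint_disjointed _
  have hDU : ⋃ k, D k = Set.univ := by
    rw [hD, iUnion_disjointed, Metric.iUnion_closedBall_nat]
  have hDb : ∀ k, IsBounded (D k) := fun k =>
    Metric.isBounded_closedBall.subset (disjointed_subset _ k)
  have hE : ∀ k j : ℕ, MeasurableSet {η : Conf X | (η.1 ∩ D k).encard = j} := fun k j =>
    Conf.measurable_encard (hDm k) (measurableSet_singleton _)
  set κ : ℕ → ℕ → Kernel (Conf X) X := fun k j =>
    Kernel.piecewise (hE k j) ((countKernel X).restrict (hDm k)) 0 with hκ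
  have hfin : ∀ k j, IsFiniteKernel (κ k j) := by
    intro k j
    refine ⟨j, ENNReal.natCast_lt_top j, fun η => ?_⟩
    rw [hκ, Kernel.piecewise_apply]
    split_ifs with h
    · rw [Kernel.restrict_apply, Measure.restrict_apply_univ, countKernel_apply η (hDm k)]
      rw [Set.mem_ofPred_eq] at h
      rw [h]
      simp
    · simp
  have heq : countKernel X = Kernel.sum fun k => Kernel.sum fun j => κ k j := by
    ext η A hA
    rw [Kernel.sum_apply' _ _ hA]
    have h1 : ∀ k, Kernel.sum (fun j => κ k j) η A = countKernel X η (A ∩ D k) := by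
      intro k
      rw [Kernel.sum_apply' _ _ hA]
      have hf := η.finite_inter (hDb k)
      obtain ⟨m, hm⟩ : ∃ m : ℕ, (η.1 ∩ D k).encard = m :=
        ⟨_, (hf.cast_ncard_eq).symm⟩
      rw [tsum_eq_single m]
      · rw [hκ, Kernel.piecewise_apply, if_pos (by exact hm), Kernel.restrict_apply,
          Measure.restrict_apply hA]
      · intro j hj
        rw [hκ, Kernel.piecewise_apply, if_neg]
        · simp
        · intro h
          rw [Set.mem_ofPred_eq, hm] at h
          exact hj (by exact_mod_cast h.symm)
    simp_rw [h1]
    rw [← measure_iUnion (fun i j hij => (hDd hij).mono Set.inter_subset_right Set.inter_subset_right)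
      (fun k => hA.inter (hDm k)), ← Set.inter_iUnion, hDU, Set.inter_univ]
  rw [heq]
  infer_instance

/-- The number of points of a random configuration in a random set is measurable. -/
lemma Conf.measurable_encard_section {α : Type*} [MeasurableSpace α] {g : α → Conf X}
    (hg : Measurable g) {D : Set (α × X)} (hD : MeasurableSet D) :
    Measurable fun a => ((g a).1 ∩ {x | (a, x) ∈ D}).encard := by
  have h := Kernel.measurable_kernel_prodMk_left (κ := (countKernel X).comap g hg) hD
  have h2 : (fun a => ((((g a).1 ∩ {x | (a, x) ∈ D}).encard : ℕ∞) : ENNReal))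
      = fun a => (countKernel X).comap g hg a (Prod.mk a ⁻¹' D) := by
    funext a
    rw [Kernel.comap_apply, countKernel_apply _ (measurable_prodMk_left hD)]
    rfl
  rw [← h2] at h
  refine ENat.measurable_iff.2 fun n => ?_
  convert h (measurableSet_singleton (n : ENNReal)) using 1
  ext a
  simp only [Set.mem_preimage, Set.mem_singleton_iff]
  norm_cast

lemma Conf.measurableSet_void_section {α : Type*} [MeasurableSpace α] {g : α → Conf X}
    (hg : Measurable g) {D : Set (α × X)} (hD : MeasurableSet D) :
    MeasurableSet {a | ∀ x ∈ (g a).1, (a, x) ∉ D} := by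
  convert Conf.measurable_encard_section hg hD (measurableSet_singleton 0) using 1
  ext a
  simp [Set.eq_empty_iff_forall_notMem]

end Configurations

/-! ### Walks, covering, and the flow property -/

section Walks

variable {d : ℕ}

/-- The position `y` is hit by an obstacle of `S` during the time interval `(a, b]`. -/
def Covered (S : Set (Space d × ℝ)) (y : Space d) (a b : ℝ) : Prop :=
  ∃ s ∈ S, a < s.2 ∧ s.2 ≤ b ∧ dist y s.1 ≤ 1

lemma Covered.mono {S : Set (Space d × ℝ)} {y : Space d} {a b a' b' : ℝ} (h : Covered S y a b)
    (ha : a' ≤ a) (hb : b ≤ b') : Covered S y a' b' := by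
  obtain ⟨s, hs, h1, h2, h3⟩ := h
  exact ⟨s, hs, ha.trans_lt h1, h2.trans hb, h3⟩

lemma not_covered_self (S : Set (Space d × ℝ)) (y : Space d) (a : ℝ) : ¬ Covered S y a a := by
  rintro ⟨s, -, h1, h2, -⟩
  exact absurd h1 (not_lt.2 h2)

lemma forall_hitTimes_iff (S : Set (Space d × ℝ)) (s : Space d × ℝ) (t : ℝ) :
    (∀ u ∈ hitTimes S s, t < u) ↔ ¬ Covered S s.1 s.2 t := by
  constructor
  · rintro h ⟨s', hs', h1, h2, h3⟩
    exact absurd (h s'.2 ⟨h1, s'.1, hs', h3⟩) (not_lt.2 h2)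
  · rintro h u ⟨h1, x', hx', h3⟩
    by_contra hu
    exact h ⟨(x', u), hx', h1, not_lt.1 hu, h3⟩

/-- The first hitting time is attained because the obstacles met up to a given hitting time `t` are
centred in a bounded cylinder, which contains finitely many points of `S`. -/
lemma exists_isMother (S : Conf (Space d × ℝ)) {s : Space d × ℝ} (h : (hitTimes S.1 s).Nonempty) :
    ∃ s', IsMother S.1 s s' := by
  obtain ⟨t, ht⟩ := h
  have hfin : (hitTimes S.1 s ∩ Set.Iic t).Finite := by
    have hb : IsBounded (Metric.closedBall s.1 1 ×ˢ Set.Icc s.2 t) :=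
      Metric.isBounded_closedBall.prod (Metric.isBounded_Icc _ _)
    refine ((S.finite_inter hb).image Prod.snd).subset ?_
    rintro u ⟨⟨h1, x', hx', h3⟩, hu⟩
    refine ⟨(x', u), ⟨hx', ?_, h1.le, hu⟩, rfl⟩
    rw [Metric.mem_closedBall] at h3 ⊢
    rwa [dist_comm]
  obtain ⟨m, hm, hmin⟩ := Set.exists_min_image _ id hfin ⟨t, ht, Set.mem_Iic.2 le_rfl⟩
  obtain ⟨⟨h1, x', hx', h3⟩, hmt⟩ := hm
  refine ⟨(x', m), hx', h3, ⟨h1, x', hx', h3⟩, fun u hu => ?_⟩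
  rcases le_total u t with hut | hut
  · exact hmin u ⟨hu, hut⟩
  · exact le_trans hmt hut

lemma isMother_mother (S : Conf (Space d × ℝ)) {s : Space d × ℝ}
    (h : (hitTimes S.1 s).Nonempty) : IsMother S.1 s (mother S.1 s) := by
  have h' := exists_isMother S h
  unfold mother
  rw [dif_pos h']
  exact h'.choose_spec

lemma mother_eq_self_or (S : Conf (Space d × ℝ)) (s : Space d × ℝ) :
    mother S.1 s = s ∨ (mother S.1 s ∈ S.1 ∧ s.2 ≤ (mother S.1 s).2) := by
  by_cases h : ∃ s', IsMother S.1 s s'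
  · obtain ⟨s', hs'⟩ := h
    have := isMother_mother S ⟨_, hs'.2.2.1⟩
    exact Or.inr ⟨this.1, this.2.2.1.1.le⟩
  · left
    unfold mother
    rw [dif_neg h]

lemma iterate_mother_eq_self_or (S : Conf (Space d × ℝ)) (s : Space d × ℝ) (n : ℕ) :
    (mother S.1)^[n] s = s ∨ ((mother S.1)^[n] s ∈ S.1 ∧ s.2 ≤ ((mother S.1)^[n] s).2) := by
  induction n with
  | zero => exact Or.inl rfl
  | succ n ih =>
    rw [Function.iterate_succ_apply']
    rcases mother_eq_self_or S ((mother S.1)^[n] s) with h | h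
    · rw [h]
      exact ih
    · refine Or.inr ⟨h.1, le_trans ?_ h.2⟩
      rcases ih with ih | ih
      · rw [ih]
      · exact ih.2

lemma walkAt_of_not_covered {S : Set (Space d × ℝ)} {s : Space d × ℝ} {t : ℝ} (hst : s.2 ≤ t)
    (h : ¬ Covered S s.1 s.2 t) : WalkAt S s t s.1 :=
  ⟨0, rfl, hst, (forall_hitTimes_iff S s t).2 h⟩

/-- After its first jump a walk follows the walk of a point of `S`. -/
lemma WalkAt.eq_or_exists {S : Conf (Space d × ℝ)} {s : Space d × ℝ} {t : ℝ} {y : Space d}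
    (h : WalkAt S.1 s t y) : (y = s.1 ∧ s.2 ≤ t ∧ ¬ Covered S.1 y s.2 t) ∨
      ∃ r, (y, r) ∈ S.1 ∧ s.2 ≤ r ∧ r ≤ t ∧ ¬ Covered S.1 y r t := by
  obtain ⟨n, rfl, h2, h3⟩ := h
  rw [forall_hitTimes_iff] at h3
  rcases iterate_mother_eq_self_or S s n with h | h
  · left
    rw [h] at h2 h3 ⊢
    exact ⟨rfl, h2, h3⟩
  · exact Or.inr ⟨_, h.1, h.2, h2, h3⟩

/-- Genealogies disappear here: a walk that has jumped can be replaced by the walk of the point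
where it now sits, so it suffices to consider walks that have not moved. -/
lemma mem_processFrom (S : Conf (Space d × ℝ)) (η : Set (Space d)) {t' t : ℝ} (htt : t' ≤ t)
    (y : Space d) : y ∈ processFrom S.1 η t' t ↔ (y ∈ η ∧ ¬ Covered S.1 y t' t) ∨
      ∃ r, (y, r) ∈ S.1 ∧ t' ≤ r ∧ r ≤ t ∧ ¬ Covered S.1 y r t := by
  constructor
  · rintro ⟨s, hs, hw⟩
    rcases hw.eq_or_exists with ⟨rfl, h2, h3⟩ | ⟨r, hr, h1, h2, h3⟩
    · rcases hs with ⟨hs1, hs2, hs3⟩ | ⟨hs1, rfl⟩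
      · exact Or.inr ⟨s.2, hs1, hs2, hs3, h3⟩
      · exact Or.inl ⟨hs1, h3⟩
    · refine Or.inr ⟨r, hr, le_trans ?_ h1, h2, h3⟩
      rcases hs with ⟨_, hs2, _⟩ | ⟨_, rfl⟩
      · exact hs2
      · exact le_rfl
  · rintro (⟨h1, h2⟩ | ⟨r, hr, h1, h2, h3⟩)
    · exact ⟨(y, t'), Or.inr ⟨h1, rfl⟩, walkAt_of_not_covered (s := (y, t')) htt h2⟩
    · exact ⟨(y, r), Or.inl ⟨hr, h1, h2⟩, walkAt_of_not_covered (s := (y, r)) h2 h3⟩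

lemma mem_processAt (S : Conf (Space d × ℝ)) (t : ℝ) (y : Space d) :
    y ∈ processAt S.1 t ↔ ∃ r, (y, r) ∈ S.1 ∧ r ≤ t ∧ ¬ Covered S.1 y r t := by
  constructor
  · rintro ⟨s, hs, hst, hw⟩
    rcases hw.eq_or_exists with ⟨rfl, h2, h3⟩ | ⟨r, hr, -, h2, h3⟩
    · exact ⟨s.2, hs, hst, h3⟩
    · exact ⟨r, hr, h2, h3⟩
  · rintro ⟨r, hr, h2, h3⟩
    exact ⟨(y, r), hr, h2, walkAt_of_not_covered (s := (y, r)) h2 h3⟩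

lemma processFrom_locallyFinite (S : Conf (Space d × ℝ)) (η : Conf (Space d)) {t' t : ℝ}
    (htt : t' ≤ t) (K : Set (Space d)) (hK : IsBounded K) :
    (processFrom S.1 η.1 t' t ∩ K).Finite := by
  have hb : IsBounded (K ×ˢ Set.Icc t' t) := hK.prod (Metric.isBounded_Icc _ _)
  refine ((η.finite_inter hK).union ((S.finite_inter hb).image Prod.fst)).subset ?_
  rintro y ⟨hy, hyK⟩
  rcases (mem_processFrom S η.1 htt y).1 hy with ⟨h1, -⟩ | ⟨r, hr, h1, h2, -⟩
  · exact Or.inl ⟨h1, hyK⟩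
  · exact Or.inr ⟨(y, r), ⟨hr, hyK, h1, h2⟩, rfl⟩

/-- The process started from `η` at time `0`, as a configuration. -/
noncomputable def evolve (t : ℝ) (S : Conf (Space d × ℝ)) (η : Conf (Space d)) : Conf (Space d) :=
  Conf.ofSet (processFrom S.1 η.1 0 t)

lemma evolve_val {t : ℝ} (ht : 0 ≤ t) (S : Conf (Space d × ℝ)) (η : Conf (Space d)) :
    (evolve t S η).1 = processFrom S.1 η.1 0 t :=
  Conf.ofSet_val (processFrom_locallyFinite S η ht)

lemma mem_evolve {t : ℝ} (ht : 0 ≤ t) (S : Conf (Space d × ℝ)) (η : Conf (Space d))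
    (y : Space d) : y ∈ (evolve t S η).1 ↔ (y ∈ η.1 ∧ ¬ Covered S.1 y 0 t) ∨
      ∃ r, (y, r) ∈ S.1 ∧ 0 ≤ r ∧ r ≤ t ∧ ¬ Covered S.1 y r t := by
  rw [evolve_val ht, mem_processFrom S η.1 ht]

/-- The configuration translated in time by `-c`. -/
def timeShift (c : ℝ) (S : Conf (Space d × ℝ)) : Conf (Space d × ℝ) :=
  ⟨{p | (p.1, p.2 + c) ∈ S.1}, fun K hK => by
    have hb : IsBounded ((fun p : Space d × ℝ => p + (0, c)) '' K) :=
      (LipschitzWith.of_dist_le_mul (K := 1) (fun x y => by simp)).isBounded_image hK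
    refine ((S.finite_inter hb).preimage (f := fun p : Space d × ℝ => p + (0, c))
      (add_left_injective _).injOn).subset ?_
    rintro ⟨x, r⟩ ⟨hp, hpK⟩
    refine ⟨?_, _, hpK, rfl⟩
    simpa using hp⟩

lemma mem_timeShift {c : ℝ} {S : Conf (Space d × ℝ)} {p : Space d × ℝ} :
    p ∈ (timeShift c S).1 ↔ (p.1, p.2 + c) ∈ S.1 := Iff.rfl

/-- The points of `S` up to time `s`, followed by those of `S'` from time `0` on. -/
def concat (s : ℝ) (S S' : Conf (Space d × ℝ)) : Conf (Space d × ℝ) :=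
  ⟨{p | (p.2 ≤ s ∧ p ∈ S.1) ∨ (s < p.2 ∧ p ∈ (timeShift (-s) S').1)}, fun K hK => by
    refine ((S.finite_inter hK).union ((timeShift (-s) S').finite_inter hK)).subset ?_
    rintro p ⟨hp | hp, hpK⟩
    · exact Or.inl ⟨hp.2, hpK⟩
    · exact Or.inr ⟨hp.2, hpK⟩⟩

lemma mem_concat {s : ℝ} {S S' : Conf (Space d × ℝ)} {p : Space d × ℝ} :
    p ∈ (concat s S S').1 ↔ (p.2 ≤ s ∧ p ∈ S.1) ∨ (s < p.2 ∧ (p.1, p.2 - s) ∈ S'.1) := Iff.rfl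

lemma covered_concat_of_le {s : ℝ} {S S' : Conf (Space d × ℝ)} {y : Space d} {a b : ℝ}
    (hb : b ≤ s) : Covered (concat s S S').1 y a b ↔ Covered S.1 y a b := by
  constructor
  · rintro ⟨p, hp, h1, h2, h3⟩
    rcases mem_concat.1 hp with hp | hp
    · exact ⟨p, hp.2, h1, h2, h3⟩
    · exact absurd hp.1 (not_lt.2 (h2.trans hb))
  · rintro ⟨p, hp, h1, h2, h3⟩
    exact ⟨p, mem_concat.2 (Or.inl ⟨h2.trans hb, hp⟩), h1, h2, h3⟩

lemma covered_concat_of_ge {s : ℝ} {S S' : Conf (Space d × ℝ)} {y : Space d} {a b : ℝ}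
    (ha : s ≤ a) : Covered (concat s S S').1 y a b ↔ Covered S'.1 y (a - s) (b - s) := by
  constructor
  · rintro ⟨p, hp, h1, h2, h3⟩
    rcases mem_concat.1 hp with hp | hp
    · exact absurd hp.1 (not_le.2 (ha.trans_lt h1))
    · exact ⟨_, hp.2, sub_lt_sub_right h1 s, sub_le_sub_right h2 s, h3⟩
  · rintro ⟨p, hp, h1, h2, h3⟩
    refine ⟨(p.1, p.2 + s), mem_concat.2 (Or.inr ⟨?_, ?_⟩), ?_, ?_, h3⟩
    · change s < p.2 + s
      linarith
    · simpa using hp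
    · change a < p.2 + s
      linarith
    · change p.2 + s ≤ b
      linarith

lemma covered_split {S : Set (Space d × ℝ)} {y : Space d} {a b c : ℝ} (hab : a ≤ b) (hbc : b ≤ c) :
    Covered S y a c ↔ Covered S y a b ∨ Covered S y b c := by
  constructor
  · rintro ⟨p, hp, h1, h2, h3⟩
    rcases le_or_gt p.2 b with h | h
    · exact Or.inl ⟨p, hp, h1, h, h3⟩
    · exact Or.inr ⟨p, hp, h, h2, h3⟩
  · rintro (h | h)
    · exact h.mono le_rfl hbc
    · exact h.mono hab le_rfl

/-- The flow property of the process. -/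
lemma evolve_concat {s t : ℝ} (hs : 0 ≤ s) (ht : 0 ≤ t) (S S' : Conf (Space d × ℝ))
    (h0 : ∀ p ∈ S'.1, p.2 ≠ 0) (η : Conf (Space d)) :
    evolve (s + t) (concat s S S') η = evolve t S' (evolve s S η) := by
  apply Subtype.ext
  ext y
  have hst : s ≤ s + t := by linarith
  rw [mem_evolve (by linarith), mem_evolve ht, mem_evolve hs, covered_split hs hst,
    covered_concat_of_le le_rfl, covered_concat_of_ge le_rfl, sub_self, add_sub_cancel_left]
  constructor
  · rintro (⟨h1, h2⟩ | ⟨r, hr, h1, h2, h3⟩)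
    · push Not at h2
      exact Or.inl ⟨Or.inl ⟨h1, h2.1⟩, h2.2⟩
    · rcases mem_concat.1 hr with hr | hr
      · replace hr : r ≤ s ∧ (y, r) ∈ S.1 := hr
        rw [covered_split hr.1 hst, covered_concat_of_le le_rfl, covered_concat_of_ge le_rfl,
          sub_self, add_sub_cancel_left] at h3
        push Not at h3
        exact Or.inl ⟨Or.inr ⟨r, hr.2, h1, hr.1, h3.1⟩, h3.2⟩
      · replace hr : s < r ∧ (y, r - s) ∈ S'.1 := hr
        rw [covered_concat_of_ge hr.1.le, add_sub_cancel_left] at h3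
        exact Or.inr ⟨r - s, hr.2, by linarith, by linarith, h3⟩
  · rintro (⟨⟨h1, h2⟩ | ⟨r, hr, h1, h2, h3⟩, h4⟩ | ⟨r, hr, h1, h2, h3⟩)
    · left
      push Not
      exact ⟨h1, h2, h4⟩
    · refine Or.inr ⟨r, mem_concat.2 (Or.inl ⟨h2, hr⟩), h1, by linarith, ?_⟩
      rw [covered_split h2 hst, covered_concat_of_le le_rfl, covered_concat_of_ge le_rfl,
          sub_self, add_sub_cancel_left]
      push Not
      exact ⟨h3, h4⟩
    · have hr0 : 0 < r := lt_of_le_of_ne h1 fun h => h0 _ hr h.symm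
      refine Or.inr ⟨r + s, mem_concat.2 (Or.inr ⟨?_, ?_⟩), by linarith, by linarith, ?_⟩
      · change s < r + s
        linarith
      · simpa using hr
      · rw [covered_concat_of_ge (by linarith), add_sub_cancel_left, add_sub_cancel_right]
        exact h3

lemma covered_timeShift {c : ℝ} {S : Conf (Space d × ℝ)} {y : Space d} {a b : ℝ} :
    Covered (timeShift c S).1 y a b ↔ Covered S.1 y (a + c) (b + c) := by
  constructor
  · rintro ⟨p, hp, h1, h2, h3⟩
    exact ⟨_, hp, add_lt_add_left h1 c, add_le_add_left h2 c, h3⟩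
  · rintro ⟨p, hp, h1, h2, h3⟩
    refine ⟨(p.1, p.2 - c), ?_, ?_, ?_, h3⟩
    · rw [mem_timeShift]
      simpa using hp
    · change a < p.2 - c
      linarith
    · change p.2 - c ≤ b
      linarith

lemma processAt_timeShift (c t : ℝ) (S : Conf (Space d × ℝ)) :
    processAt (timeShift c S).1 t = processAt S.1 (t + c) := by
  ext y
  rw [mem_processAt, mem_processAt]
  constructor
  · rintro ⟨r, hr, h1, h2⟩
    rw [covered_timeShift] at h2
    exact ⟨r + c, hr, by linarith, h2⟩
  · rintro ⟨r, hr, h1, h2⟩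
    refine ⟨r - c, ?_, by linarith, ?_⟩
    · rw [mem_timeShift]
      simpa using hr
    · rwa [covered_timeShift, sub_add_cancel]

/-- Where everything has been hit since time `0`, the initial configuration is forgotten. -/
lemma mem_evolve_iff_mem_processAt {t : ℝ} (ht : 0 ≤ t) (S : Conf (Space d × ℝ))
    (η : Conf (Space d)) {y : Space d} (hy : Covered S.1 y 0 t) :
    y ∈ (evolve t S η).1 ↔ y ∈ processAt S.1 t := by
  rw [mem_evolve ht, mem_processAt]
  constructor
  · rintro (⟨-, h⟩ | ⟨r, hr, -, h2, h3⟩)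
    · exact absurd hy h
    · exact ⟨r, hr, h2, h3⟩
  · rintro ⟨r, hr, h2, h3⟩
    refine Or.inr ⟨r, hr, ?_, h2, h3⟩
    by_contra h
    exact h3 (hy.mono (not_le.1 h).le le_rfl)

/-- Radius 1/2 makes any two points of a ball lie within distance 1, so one obstacle centred in the
ball covers all of it. Centres from a fixed countable family keep `EverywhereHit` a countable
intersection. -/
lemma exists_finset_cover {K : Set (Space d)} (hK : IsBounded K) :
    ∃ I : Finset ℕ, ∀ x ∈ K, ∃ i ∈ I,
      x ∈ Metric.closedBall (TopologicalSpace.denseSeq (Space d) i) (1 / 2) := by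
  obtain ⟨I, hI⟩ := hK.isCompact_closure.elim_finite_subcover
    (fun i => Metric.ball (TopologicalSpace.denseSeq (Space d) i) (1 / 2))
    (fun _ => Metric.isOpen_ball) (fun x _ => by
      obtain ⟨i, hi⟩ := Metric.denseRange_iff.1 (TopologicalSpace.denseRange_denseSeq (Space d)) x
        (1 / 2) (by norm_num)
      exact Set.mem_iUnion.2 ⟨i, hi⟩)
  refine ⟨I, fun x hx => ?_⟩
  have := hI (subset_closure hx)
  simp only [Set.mem_iUnion, exists_prop] at this
  obtain ⟨i, hi, hxi⟩ := this
  exact ⟨i, hi, Metric.ball_subset_closedBall hxi⟩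

/-- Every ball of a fixed countable cover of the space contains a point of `S` born by time `t`. -/
def EverywhereHit (S : Set (Space d × ℝ)) (t : ℝ) : Prop :=
  ∀ i : ℕ, ∃ p ∈ S, p.1 ∈ Metric.closedBall (TopologicalSpace.denseSeq (Space d) i) (1 / 2) ∧
    p.2 ≤ t

lemma dist_le_one_of_mem_closedBall_half {x y z : Space d} (hx : x ∈ Metric.closedBall z (1 / 2))
    (hy : y ∈ Metric.closedBall z (1 / 2)) : dist x y ≤ 1 := by
  rw [Metric.mem_closedBall] at hx hy
  linarith [dist_triangle_right x y z]

/-- Finitely many small balls cover `K`, and each contains a point born by time `t`. Anything in `K`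
born before the earliest time `T` of these points has been covered since, so the survivors come from
the bounded set `K × [T, t]`. -/
lemma processAt_locallyFinite (S : Conf (Space d × ℝ)) {t : ℝ} (h : EverywhereHit S.1 t)
    (K : Set (Space d)) (hK : IsBounded K) : (processAt S.1 t ∩ K).Finite := by
  obtain ⟨I, hI⟩ := exists_finset_cover hK
  choose p hpS hpB hpt using h
  obtain ⟨T, hT⟩ : BddBelow ((fun i => (p i).2) '' (I : Set ℕ)) :=
    (I.finite_toSet.image _).bddBelow
  have hb : IsBounded (K ×ˢ Set.Icc T t) := hK.prod (Metric.isBounded_Icc _ _)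
  refine ((S.finite_inter hb).image Prod.fst).subset ?_
  rintro y ⟨hy, hyK⟩
  obtain ⟨r, hr, h1, h2⟩ := (mem_processAt S t y).1 hy
  refine ⟨(y, r), ⟨hr, hyK, ?_, h1⟩, rfl⟩
  by_contra hrT
  obtain ⟨i, hi, hyi⟩ := hI y hyK
  refine h2 ⟨p i, hpS i, (not_le.1 hrT).trans_le (hT ⟨i, hi, rfl⟩), hpt i, ?_⟩
  exact dist_le_one_of_mem_closedBall_half hyi (hpB i)

end Walks

/-! ### Measurability of the process -/

section Measurability

variable {d : ℕ} {β : Type*} [MeasurableSpace β]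

/-- The site and the times may vary with the parameter, since the lemma is applied with `(y, r)`
ranging over candidate points of the configuration itself. -/
lemma measurableSet_covered {g : β → Conf (Space d × ℝ)} (hg : Measurable g) {y : β → Space d}
    (hy : Measurable y) {a b : β → ℝ} (ha : Measurable a) (hb : Measurable b) :
    MeasurableSet {x | Covered (g x).1 (y x) (a x) (b x)} := by
  have hD : MeasurableSet {q : β × (Space d × ℝ) |
      a q.1 < q.2.2 ∧ q.2.2 ≤ b q.1 ∧ dist (y q.1) q.2.1 ≤ 1} :=
    ((measurableSet_lt (ha.comp measurable_fst) (measurable_snd.comp measurable_snd)).inter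
      ((measurableSet_le (measurable_snd.comp measurable_snd) (hb.comp measurable_fst)).inter
      (measurableSet_le ((hy.comp measurable_fst).dist (measurable_fst.comp measurable_snd))
        measurable_const)))
  convert (Conf.measurableSet_void_section hg hD).compl using 1
  ext x
  simp [Covered]

/-- Joint measurability is what Fubini requires in the semigroup property, where the initial
configuration is itself random. -/
lemma measurable_evolve {t : ℝ} (ht : 0 ≤ t) :
    Measurable fun q : Conf (Space d × ℝ) × Conf (Space d) => evolve t q.1 q.2 := by
  refine Conf.measurable_of_void fun A hA _ => ?_
  have h1 : MeasurableSet {x : (Conf (Space d × ℝ) × Conf (Space d)) × Space d |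
      x.2 ∈ A ∧ ¬ Covered x.1.1.1 x.2 0 t} :=
    (measurable_snd hA).inter (measurableSet_covered (measurable_fst.comp measurable_fst)
      measurable_snd measurable_const measurable_const).compl
  have h2 : MeasurableSet {x : (Conf (Space d × ℝ) × Conf (Space d)) × (Space d × ℝ) |
      (x.2.1 ∈ A ∧ 0 ≤ x.2.2 ∧ x.2.2 ≤ t) ∧ ¬ Covered x.1.1.1 x.2.1 x.2.2 t} :=
    (((measurable_fst.comp measurable_snd) hA).inter
      ((measurableSet_le measurable_const (measurable_snd.comp measurable_snd)).inter
      (measurableSet_le (measurable_snd.comp measurable_snd) measurable_const))).inter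
      (measurableSet_covered (measurable_fst.comp measurable_fst)
      (measurable_fst.comp measurable_snd) (measurable_snd.comp measurable_snd)
      measurable_const).compl
  convert (Conf.measurableSet_void_section measurable_snd h1).inter
    (Conf.measurableSet_void_section measurable_fst h2) using 1
  ext ⟨S, η⟩
  simp only [Set.eq_empty_iff_forall_notMem, Set.mem_inter_iff, Set.mem_ofPred_eq, mem_evolve ht]
  constructor
  · intro h
    exact ⟨fun y hy hA => h y ⟨Or.inl ⟨hy, hA.2⟩, hA.1⟩, fun p hp hA =>
      h p.1 ⟨Or.inr ⟨p.2, hp, hA.1.2.1, hA.1.2.2, hA.2⟩, hA.1.1⟩⟩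
  · rintro ⟨h1, h2⟩ y ⟨⟨hy, hc⟩ | ⟨r, hr, h3, h4, h5⟩, hyA⟩
    · exact h1 y hy ⟨hyA, hc⟩
    · exact h2 (y, r) hr ⟨⟨hyA, h3, h4⟩, h5⟩

lemma measurable_timeShift (c : ℝ) :
    Measurable (timeShift c : Conf (Space d × ℝ) → Conf (Space d × ℝ)) := by
  refine Conf.measurable_of_void fun A hA _ => ?_
  have hsh : Measurable fun p : Space d × ℝ => (p.1, p.2 - c) := by fun_prop
  convert Conf.measurableSet_void (hsh hA) using 1
  ext S
  simp only [Set.eq_empty_iff_forall_notMem, Set.mem_inter_iff, Set.mem_ofPred_eq, mem_timeShift,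
    Set.mem_preimage]
  constructor
  · rintro h p ⟨hp, hpA⟩
    exact h _ ⟨by simpa using hp, hpA⟩
  · rintro h p ⟨hp, hpA⟩
    exact h _ ⟨hp, by simpa using hpA⟩

lemma concat_inter_eq_empty_iff {s : ℝ} {S S' : Conf (Space d × ℝ)} {A : Set (Space d × ℝ)} :
    (concat s S S').1 ∩ A = ∅ ↔ S.1 ∩ (A ∩ {p | p.2 ≤ s}) = ∅ ∧
      (timeShift (-s) S').1 ∩ (A ∩ {p | s < p.2}) = ∅ := by
  simp only [Set.eq_empty_iff_forall_notMem, Set.mem_inter_iff, Set.mem_ofPred_eq]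
  constructor
  · intro h
    exact ⟨fun p hp => h p ⟨Or.inl ⟨hp.2.2, hp.1⟩, hp.2.1⟩,
      fun p hp => h p ⟨Or.inr ⟨hp.2.2, hp.1⟩, hp.2.1⟩⟩
  · rintro ⟨h1, h2⟩ p ⟨hp | hp, hpA⟩
    · exact h1 p ⟨hp.2, hpA, hp.1⟩
    · exact h2 p ⟨hp.2, hpA, hp.1⟩

lemma measurableSet_snd_le (s : ℝ) : MeasurableSet {p : Space d × ℝ | p.2 ≤ s} :=
  measurableSet_le measurable_snd measurable_const

lemma measurableSet_lt_snd (s : ℝ) : MeasurableSet {p : Space d × ℝ | s < p.2} :=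
  measurableSet_lt measurable_const measurable_snd

lemma measurable_concat (s : ℝ) :
    Measurable fun q : Conf (Space d × ℝ) × Conf (Space d × ℝ) => concat s q.1 q.2 := by
  refine Conf.measurable_of_void fun A hA _ => ?_
  simp only [concat_inter_eq_empty_iff]
  exact (measurable_fst (Conf.measurableSet_void (hA.inter (measurableSet_snd_le s)))).inter
    (((measurable_timeShift (-s)).comp measurable_snd)
      (Conf.measurableSet_void (hA.inter (measurableSet_lt_snd s))))

lemma mem_update {η : Conf (Space d)} {u y : Space d} :
    y ∈ (update η u).1 ↔ (y ∈ η.1 ∧ ¬ dist y u ≤ 1) ∨ y = u := Iff.rfl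

lemma measurable_update (η : Conf (Space d)) : Measurable (update η) := by
  refine Conf.measurable_of_void fun A hA _ => ?_
  have hD : MeasurableSet {x : Space d × Space d | x.2 ∈ A ∧ ¬ dist x.2 x.1 ≤ 1} :=
    (measurable_snd hA).inter
      (measurableSet_le (measurable_snd.dist measurable_fst) measurable_const).compl
  convert hA.compl.inter (Conf.measurableSet_void_section (g := fun _ : Space d => η)
    measurable_const hD) using 1
  ext u
  simp only [Set.eq_empty_iff_forall_notMem, Set.mem_inter_iff, Set.mem_ofPred_eq, mem_update,
    Set.mem_compl_iff]
  constructor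
  · intro h
    exact ⟨fun hu => h u ⟨Or.inr rfl, hu⟩, fun y hy hA => h y ⟨Or.inl ⟨hy, hA.2⟩, hA.1⟩⟩
  · rintro ⟨h1, h2⟩ y ⟨⟨hy, hc⟩ | rfl, hyA⟩
    · exact h2 y hy ⟨hyA, hc⟩
    · exact h1 hyA

lemma measurableSet_everywhereHit (t : ℝ) :
    MeasurableSet {S : Conf (Space d × ℝ) | EverywhereHit S.1 t} := by
  unfold EverywhereHit
  rw [Set.ofPred_forall]
  refine MeasurableSet.iInter fun i => ?_
  have hA : MeasurableSet (Metric.closedBall (TopologicalSpace.denseSeq (Space d) i) (1 / 2) ×ˢ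
      Set.Iic t) := Metric.isClosed_closedBall.measurableSet.prod measurableSet_Iic
  convert (Conf.measurableSet_void hA).compl using 1
  ext S
  simp [Set.eq_empty_iff_forall_notMem]

open Classical in
/-- The process started in the infinite past, at time `t`; empty in the exceptional case that some
ball is never hit. -/
noncomputable def pastProcess (t : ℝ) (S : Conf (Space d × ℝ)) : Conf (Space d) :=
  if EverywhereHit S.1 t then Conf.ofSet (processAt S.1 t) else Conf.ofSet ∅

lemma pastProcess_eq {t : ℝ} {S : Conf (Space d × ℝ)} (h : EverywhereHit S.1 t) :
    pastProcess t S = Conf.ofSet (processAt S.1 t) := if_pos h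

/-- On `EverywhereHit` the set is locally finite, so `Conf.ofSet` returns it unchanged; elsewhere
the value is empty. Avoiding `A` is therefore an explicit event in both cases. -/
lemma measurable_pastProcess (t : ℝ) :
    Measurable (pastProcess t : Conf (Space d × ℝ) → Conf (Space d)) := by
  refine Conf.measurable_of_void fun A hA _ => ?_
  have h2 : MeasurableSet {x : Conf (Space d × ℝ) × (Space d × ℝ) |
      (x.2.1 ∈ A ∧ x.2.2 ≤ t) ∧ ¬ Covered x.1.1 x.2.1 x.2.2 t} :=
    (((measurable_fst.comp measurable_snd) hA).inter
      (measurableSet_le (measurable_snd.comp measurable_snd) measurable_const)).inter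
      (measurableSet_covered measurable_fst (measurable_fst.comp measurable_snd)
      (measurable_snd.comp measurable_snd) measurable_const).compl
  convert (measurableSet_everywhereHit t).compl.union
    (Conf.measurableSet_void_section measurable_id h2) using 1
  ext S
  by_cases h : EverywhereHit S.1 t
  · simp only [pastProcess_eq h, Conf.ofSet_val (processAt_locallyFinite S h),
      Set.eq_empty_iff_forall_notMem, Set.mem_inter_iff, Set.mem_ofPred_eq, mem_processAt,
      Set.mem_union, Set.mem_compl_iff, h, not_true_eq_false, false_or, id]
    constructor
    · rintro h p hp ⟨⟨h1, h2⟩, h3⟩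
      exact h p.1 ⟨⟨p.2, hp, h2, h3⟩, h1⟩
    · rintro h y ⟨⟨r, hr, h2, h3⟩, hy⟩
      exact h (y, r) hr ⟨⟨hy, h2⟩, h3⟩
  · have : (pastProcess t S).1 = ∅ := by
      unfold pastProcess
      rw [if_neg h, Conf.ofSet_val (by simp)]
    simp [this, h]

end Measurability

/-! ### Poisson void probabilities, translation and concatenation -/

section Poisson

lemma IsPoissonProcess.void_prob {X : Type*} [MetricSpace X] [MeasureSpace X] {Ω : Type*}
    [MeasurableSpace Ω] {P : Measure Ω} {lam : ℝ} (hlam : 0 ≤ lam) {S : Ω → Conf X}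
    (hS : IsPoissonProcess lam S P) {A : Set X} (hA : MeasurableSet A) (hA' : IsBounded A) :
    P {ω | (S ω).1 ∩ A = ∅} = ENNReal.ofReal (Real.exp (-(lam * (volume A).toReal))) := by
  have hm : Measurable fun ω => ((S ω).1 ∩ A).ncard := by
    have := (measurable_of_countable ENat.toNat).comp ((Conf.measurable_encard hA).comp hS.measurable)
    exact this
  have h := congrArg (fun μ => μ {0}) (hS.law_count A hA hA')
  rw [Measure.map_apply hm (measurableSet_singleton 0), poissonMeasure_singleton] at h
  convert h using 2
  · ext ω
    simp [Set.ncard_eq_zero ((S ω).finite_inter hA')]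
  · simp only [NNReal.coe_mul, Real.coe_toNNReal _ hlam, ENNReal.coe_toNNReal_eq_toReal, pow_zero,
      Nat.factorial_zero, Nat.cast_one, div_one, mul_one]

variable {d : ℕ} {Ω : Type*} [MeasurableSpace Ω]

/-- A random configuration with the void probabilities of a Poisson process of rate `lam`. -/
structure HasPoissonVoids (lam : ℝ) (S : Ω → Conf (Space d × ℝ)) (P : Measure Ω) : Prop where
  measurable : Measurable S
  void_prob : ∀ A : Set (Space d × ℝ), MeasurableSet A → IsBounded A →
    P {ω | (S ω).1 ∩ A = ∅} = ENNReal.ofReal (Real.exp (-(lam * (volume A).toReal)))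

lemma IsPoissonProcess.hasPoissonVoids {P : Measure Ω} {lam : ℝ} (hlam : 0 ≤ lam)
    {S : Ω → Conf (Space d × ℝ)} (hS : IsPoissonProcess lam S P) : HasPoissonVoids lam S P :=
  ⟨hS.measurable, fun _ hA hA' => hS.void_prob hlam hA hA'⟩

variable {P : Measure Ω} {lam : ℝ} {S : Ω → Conf (Space d × ℝ)}

lemma timeShift_inter_eq_empty_iff {c : ℝ} {S : Conf (Space d × ℝ)} {A : Set (Space d × ℝ)} :
    (timeShift c S).1 ∩ A = ∅ ↔ S.1 ∩ ((fun p => p + (0, -c)) ⁻¹' A) = ∅ := by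
  simp only [Set.eq_empty_iff_forall_notMem, Set.mem_inter_iff, mem_timeShift, Set.mem_preimage]
  constructor
  · rintro h p ⟨hp, hpA⟩
    exact h _ ⟨by simpa using hp, hpA⟩
  · rintro h p ⟨hp, hpA⟩
    exact h _ ⟨hp, by simpa using hpA⟩

lemma HasPoissonVoids.timeShift (hS : HasPoissonVoids lam S P) (c : ℝ) :
    HasPoissonVoids lam (fun ω => timeShift c (S ω)) P := by
  refine ⟨(measurable_timeShift c).comp hS.measurable, fun A hA hA' => ?_⟩
  simp only [timeShift_inter_eq_empty_iff]
  have hb : IsBounded ((fun p : Space d × ℝ => p + (0, -c)) ⁻¹' A) := by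
    have : (fun p : Space d × ℝ => p + (0, -c)) ⁻¹' A = (fun p => p + (0, c)) '' A := by
      ext p
      constructor
      · intro hp
        exact ⟨_, hp, by simp [add_assoc]⟩
      · rintro ⟨q, hq, rfl⟩
        have h : q + (0, c) + (0, -c) = q := Prod.ext (by simp) (by simp)
        exact (congrArg (· ∈ A) h).mpr hq
    rw [this]
    exact (LipschitzWith.of_dist_le_mul (K := 1) (fun x y => by simp)).isBounded_image hA'
  have : (volume : Measure (Space d × ℝ)).IsAddLeftInvariant := by
    rw [Measure.volume_eq_prod]
    infer_instance
  rw [hS.void_prob _ (measurable_add_const _ hA) hb, measure_preimage_add_right]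

/-- The volume of a ball of radius `1 / 2`. -/
noncomputable def halfBallVolume (d : ℕ) : ℝ :=
  (volume (Metric.closedBall (0 : Space d) (1 / 2))).toReal

lemma halfBallVolume_pos (d : ℕ) : 0 < halfBallVolume d :=
  ENNReal.toReal_pos (Metric.measure_closedBall_pos _ _ (by norm_num)).ne'
    Metric.isBounded_closedBall.measure_lt_top.ne

lemma HasPoissonVoids.prob_ball_not_hit (hS : HasPoissonVoids lam S P) (x : Space d) (a b : ℝ)
    (hab : a ≤ b) :
    P {ω | (S ω).1 ∩ (Metric.closedBall x (1 / 2) ×ˢ Set.Ioc a b) = ∅}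
      = ENNReal.ofReal (Real.exp (-(lam * (halfBallVolume d * (b - a))))) := by
  rw [hS.void_prob _ (Metric.isClosed_closedBall.measurableSet.prod measurableSet_Ioc)
    (Metric.isBounded_closedBall.prod (Metric.isBounded_Ioc _ _)), Measure.volume_eq_prod,
    Measure.prod_prod, Real.volume_Ioc, ENNReal.toReal_mul,
    ENNReal.toReal_ofReal (sub_nonneg.2 hab), Measure.addHaar_closedBall_center]
  rfl

/-- A given ball stays empty during `(t - n, t]` with probability exponentially small in `n`, and
there are only countably many balls. -/
lemma HasPoissonVoids.ae_everywhereHit (hS : HasPoissonVoids lam S P) (hlam : 0 < lam) (t : ℝ) :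
    ∀ᵐ ω ∂P, EverywhereHit (S ω).1 t := by
  refine ae_all_iff.2 fun i => ?_
  set q := TopologicalSpace.denseSeq (Space d) i
  have hle : ∀ n : ℕ, P {ω | ¬ ∃ p ∈ (S ω).1, p.1 ∈ Metric.closedBall q (1 / 2) ∧ p.2 ≤ t}
      ≤ ENNReal.ofReal (Real.exp (-(lam * (halfBallVolume d * n)))) := by
    intro n
    have := hS.prob_ball_not_hit q (t - n) t (by simp)
    rw [sub_sub_cancel] at this
    rw [← this]
    refine measure_mono fun ω hω => ?_
    refine Set.eq_empty_iff_forall_notMem.2 ?_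
    rintro p ⟨hp, hpB, hpt⟩
    exact hω ⟨p, hp, hpB, hpt.2⟩
  have hlim : Tendsto (fun n : ℕ => ENNReal.ofReal (Real.exp (-(lam * (halfBallVolume d * n)))))
      atTop (𝓝 0) := by
    rw [← ENNReal.ofReal_zero]
    refine ENNReal.tendsto_ofReal (Real.tendsto_exp_neg_atTop_nhds_zero.comp ?_)
    exact (tendsto_natCast_atTop_atTop.const_mul_atTop (halfBallVolume_pos d)).const_mul_atTop hlam
  exact le_antisymm (ge_of_tendsto' hlim hle) zero_le

/-- With high probability every point of a set covered by finitely many small balls is hit. -/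
lemma HasPoissonVoids.prob_not_covered (hS : HasPoissonVoids lam S P) {K : Set (Space d)}
    {I : Finset ℕ} (hI : ∀ x ∈ K, ∃ i ∈ I,
      x ∈ Metric.closedBall (TopologicalSpace.denseSeq (Space d) i) (1 / 2)) {t : ℝ} (ht : 0 ≤ t) :
    P {ω | ¬ ∀ y ∈ K, Covered (S ω).1 y 0 t}
      ≤ ENNReal.ofReal (I.card * Real.exp (-(halfBallVolume d * lam * t))) := by
  have hsub : {ω | ¬ ∀ y ∈ K, Covered (S ω).1 y 0 t} ⊆ ⋃ i ∈ I, {ω | (S ω).1 ∩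
      (Metric.closedBall (TopologicalSpace.denseSeq (Space d) i) (1 / 2) ×ˢ Set.Ioc 0 t) = ∅} := by
    intro ω hω
    by_contra hcon
    simp only [Set.mem_iUnion, Set.mem_ofPred_eq, exists_prop, not_exists, not_and,
      ← Set.nonempty_iff_ne_empty] at hcon
    refine hω fun y hy => ?_
    obtain ⟨i, hi, hyi⟩ := hI y hy
    obtain ⟨p, hp, hpB, hpt⟩ := hcon i hi
    exact ⟨p, hp, hpt.1, hpt.2, dist_le_one_of_mem_closedBall_half hyi hpB⟩
  refine (measure_mono hsub).trans ((measure_biUnion_finset_le _ _).trans ?_)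
  simp only [hS.prob_ball_not_hit _ 0 t ht, Finset.sum_const, nsmul_eq_mul]
  rw [ENNReal.ofReal_mul (by positivity), ENNReal.ofReal_natCast]
  refine le_of_eq ?_
  congr 4
  ring

variable [IsProbabilityMeasure P]

lemma HasPoissonVoids.map_eq {Ω' : Type*} [MeasurableSpace Ω'] {Q : Measure Ω'}
    [IsProbabilityMeasure Q] {S' : Ω' → Conf (Space d × ℝ)} (hS : HasPoissonVoids lam S P)
    (hS' : HasPoissonVoids lam S' Q) : P.map S = Q.map S' := by
  have := Measure.isProbabilityMeasure_map (μ := P) hS.measurable.aemeasurable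
  have := Measure.isProbabilityMeasure_map (μ := Q) hS'.measurable.aemeasurable
  refine Conf.measure_ext fun A hA hA' => ?_
  rw [Measure.map_apply hS.measurable (Conf.measurableSet_void hA),
    Measure.map_apply hS'.measurable (Conf.measurableSet_void hA)]
  exact (hS.void_prob A hA hA').trans (hS'.void_prob A hA hA').symm

/-- Cutting `A` at time `s` makes the void event a product of events for the two independent copies,
and the volumes add in the exponent. With `HasPoissonVoids.map_eq`, the noise after `s` may thus be
replaced by a fresh copy. -/
lemma HasPoissonVoids.concat (hS : HasPoissonVoids lam S P) (s : ℝ) :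
    HasPoissonVoids lam (fun q : Ω × Ω => concat s (S q.1) (S q.2)) (P.prod P) := by
  refine ⟨(measurable_concat s).comp ((hS.measurable.comp measurable_fst).prodMk
    (hS.measurable.comp measurable_snd)), fun A hA hA' => ?_⟩
  have h1 := hS.void_prob (A ∩ {p | p.2 ≤ s}) (hA.inter (measurableSet_snd_le s))
    (hA'.subset Set.inter_subset_left)
  have h2 := (hS.timeShift (-s)).void_prob (A ∩ {p | s < p.2}) (hA.inter (measurableSet_lt_snd s))
    (hA'.subset Set.inter_subset_left)
  have hset : {q : Ω × Ω | (PoissonTree.concat s (S q.1) (S q.2)).1 ∩ A = ∅}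
      = {ω | (S ω).1 ∩ (A ∩ {p | p.2 ≤ s}) = ∅} ×ˢ
        {ω | (PoissonTree.timeShift (-s) (S ω)).1 ∩ (A ∩ {p | s < p.2}) = ∅} := by
    ext q
    exact concat_inter_eq_empty_iff
  have hvol : (volume A).toReal = (volume (A ∩ {p | p.2 ≤ s})).toReal
      + (volume (A ∩ {p | s < p.2})).toReal := by
    have hd : {p : Space d × ℝ | s < p.2} = {p | p.2 ≤ s}ᶜ := by
      ext p
      simp
    rw [← ENNReal.toReal_add (hA'.subset Set.inter_subset_left).measure_lt_top.ne
      (hA'.subset Set.inter_subset_left).measure_lt_top.ne, hd, ← Set.sdiff_eq,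
      measure_inter_add_sdiff _ (measurableSet_snd_le s)]
  rw [hset, Measure.prod_prod, h1, h2, ← ENNReal.ofReal_mul (Real.exp_pos _).le, ← Real.exp_add,
    hvol]
  congr 2
  ring

/-- A time slice has volume zero. This reconciles the closed interval of birth times with the
half-open interval used for covering. -/
lemma HasPoissonVoids.ae_time_ne (hS : HasPoissonVoids lam S P) (c : ℝ) :
    ∀ᵐ ω ∂P, ∀ p ∈ (S ω).1, p.2 ≠ c := by
  have h : ∀ n : ℕ, ∀ᵐ ω ∂P, (S ω).1 ∩ (Metric.closedBall 0 n ×ˢ {c}) = ∅ := by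
    intro n
    have hA : MeasurableSet (Metric.closedBall (0 : Space d) n ×ˢ {c}) :=
      Metric.isClosed_closedBall.measurableSet.prod (measurableSet_singleton c)
    have hv : volume (Metric.closedBall (0 : Space d) n ×ˢ {c}) = 0 := by
      rw [Measure.volume_eq_prod, Measure.prod_prod]
      simp
    have := hS.void_prob _ hA (Metric.isBounded_closedBall.prod (Bornology.isBounded_singleton))
    rw [hv] at this
    rw [ENNReal.toReal_zero, mul_zero, neg_zero, Real.exp_zero, ENNReal.ofReal_one] at this
    exact (prob_compl_eq_zero_iff (hS.measurable (Conf.measurableSet_void hA))).2 this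
  filter_upwards [ae_all_iff.2 h] with ω hω p hp hpc
  obtain ⟨n, hn⟩ := exists_nat_ge ‖p.1‖
  have := Set.eq_empty_iff_forall_notMem.1 (hω n) p
  exact this ⟨hp, by simpa using hn, hpc⟩

end Poisson

/-! ### Semigroup property, exponential convergence, invariance and uniqueness -/

section Semigroup

/-- Coupling inequality. The exceptional set `B` need not be measurable, as it will involve a
quantifier over an arbitrary bounded set of sites; the proof passes to its measurable hull. -/
lemma abs_integral_sub_le_of_eq_off {Ω : Type*} [MeasurableSpace Ω] {P : Measure Ω} {F G : Ω → ℝ}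
    (hF : Integrable F P) (hG : Integrable G P) {c p : ℝ} (hc0 : 0 ≤ c)
    (hp : 0 ≤ p)    (hc : ∀ ω, |F ω - G ω| ≤ c) {B : Set Ω} (hB : ∀ᵐ ω ∂P, ω ∉ B → F ω = G ω)
    (hPB : P B ≤ ENNReal.ofReal p) : |∫ ω, F ω ∂P - ∫ ω, G ω ∂P| ≤ c * p := by
  rw [← integral_sub hF hG, ← Real.norm_eq_abs]
  have h1 := enorm_integral_le_lintegral_enorm (μ := P) (fun ω => F ω - G ω)
  have h2 : ∫⁻ ω, ‖F ω - G ω‖ₑ ∂P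
      ≤ ∫⁻ ω, (toMeasurable P B).indicator (fun _ => ENNReal.ofReal c) ω ∂P := by
    refine lintegral_mono_ae ?_
    filter_upwards [hB] with ω hω
    by_cases h : ω ∈ toMeasurable P B
    · rw [Set.indicator_of_mem h, Real.enorm_eq_ofReal_abs]
      exact ENNReal.ofReal_le_ofReal (hc ω)
    · rw [hω (fun h' => h (subset_toMeasurable P B h'))]
      simp
  rw [lintegral_indicator_const (measurableSet_toMeasurable P B), measure_toMeasurable] at h2
  have h3 : ‖∫ ω, F ω - G ω ∂P‖ₑ ≤ ENNReal.ofReal (c * p) := by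
    rw [ENNReal.ofReal_mul hc0]
    exact h1.trans (h2.trans (by gcongr))
  rw [← ofReal_norm] at h3
  exact (ENNReal.ofReal_le_ofReal_iff (by positivity)).1 h3

variable {d : ℕ} {Ω : Type*} [MeasurableSpace Ω] {P : Measure Ω}
  {lam : ℝ} {S : Ω → Conf (Space d × ℝ)} {f : Conf (Space d) → ℝ}

lemma IsBoundedLocal.integrable_comp (hf : IsBoundedLocal f) {α : Type*} [MeasurableSpace α]
    {μ : Measure α} [IsFiniteMeasure μ] {g : α → Conf (Space d)} (hg : Measurable g) :
    Integrable (fun a => f (g a)) μ := by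
  obtain ⟨M, hM⟩ := hf.bounded
  exact Integrable.of_bound (hf.measurable.comp hg).aestronglyMeasurable M
    (Eventually.of_forall fun a => hM _)

lemma measurable_evolve_comp {α : Type*} [MeasurableSpace α] {t : ℝ} (ht : 0 ≤ t)
    {g : α → Conf (Space d × ℝ)} (hg : Measurable g) {e : α → Conf (Space d)} (he : Measurable e) :
    Measurable fun a => evolve t (g a) (e a) :=
  (measurable_evolve ht).comp (hg.prodMk he)

lemma semigroup_eq (t : ℝ) (f : Conf (Space d) → ℝ) (η : Conf (Space d)) :
    semigroup P S t f η = ∫ ω, f (evolve t (S ω) η) ∂P := rfl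

lemma HasPoissonVoids.stationaryState_eq (hS : HasPoissonVoids lam S P) (hlam : 0 < lam) :
    stationaryState P S = P.map fun ω => pastProcess 0 (S ω) := by
  refine Measure.map_congr ?_
  filter_upwards [hS.ae_everywhereHit hlam 0] with ω hω
  exact (pastProcess_eq hω).symm

variable [IsProbabilityMeasure P]

/-- The initial configuration influences the occupation of `y` only through its value at `y`. Hence
supports do not grow under the semigroup. -/
lemma evolve_inter_eq {t : ℝ} (ht : 0 ≤ t) (S : Conf (Space d × ℝ)) {η ξ : Conf (Space d)}
    {Λ : Set (Space d)} (h : η.1 ∩ Λ = ξ.1 ∩ Λ) :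
    (evolve t S η).1 ∩ Λ = (evolve t S ξ).1 ∩ Λ := by
  have h' : ∀ y ∈ Λ, (y ∈ η.1 ↔ y ∈ ξ.1) := fun y hy => by
    have := Set.ext_iff.1 h y
    simpa [hy] using this
  ext y
  simp only [Set.mem_inter_iff, mem_evolve ht]
  constructor
  · rintro ⟨h1, hy⟩
    rw [h' y hy] at h1
    exact ⟨h1, hy⟩
  · rintro ⟨h1, hy⟩
    rw [← h' y hy] at h1
    exact ⟨h1, hy⟩

lemma IsBoundedLocal.semigroup (hf : IsBoundedLocal f) (hS : Measurable S) {t : ℝ} (ht : 0 ≤ t) :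
    IsBoundedLocal (semigroup P S t f) := by
  refine ⟨?_, ?_, ?_⟩
  · have h : Measurable fun q : Conf (Space d) × Ω => f (evolve t (S q.2) q.1) :=
      hf.measurable.comp (measurable_evolve_comp ht (hS.comp measurable_snd) measurable_fst)
    exact (h.stronglyMeasurable.integral_prod_right' (ν := P)).measurable
  · obtain ⟨M, hM⟩ := hf.bounded
    refine ⟨M, fun η => ?_⟩
    have := norm_integral_le_of_norm_le_const (μ := P) (f := fun ω => f (evolve t (S ω) η))
      (Eventually.of_forall fun ω => hM _)
    rw [semigroup_eq]
    simpa using this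
  · obtain ⟨Λ, hΛ, h⟩ := hf.finite_support
    refine ⟨Λ, hΛ, fun η ξ hηξ => ?_⟩
    rw [semigroup_eq, semigroup_eq]
    congr 1
    funext ω
    exact h _ _ (evolve_inter_eq ht (S ω) hηξ)

lemma evolve_zero (S : Conf (Space d × ℝ)) (h0 : ∀ p ∈ S.1, p.2 ≠ 0) (η : Conf (Space d)) :
    evolve 0 S η = η := by
  apply Subtype.ext
  ext y
  rw [mem_evolve le_rfl]
  constructor
  · rintro (h | ⟨r, hr, h1, h2, -⟩)
    · exact h.1
    · exact absurd (le_antisymm h2 h1) (h0 _ hr)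
  · exact fun h => Or.inl ⟨h, not_covered_self _ _ _⟩

lemma HasPoissonVoids.semigroup_zero (hS : HasPoissonVoids lam S P) (f : Conf (Space d) → ℝ) :
    semigroup P S 0 f = f := by
  funext η
  rw [semigroup_eq, integral_congr_ae (g := fun _ => f η)]
  · simp
  · filter_upwards [hS.ae_time_ne 0] with ω hω
    rw [evolve_zero _ hω]

/-- The law of `S` equals that of the concatenation of two independent copies; the flow property and
Fubini then separate the two time intervals. -/
lemma HasPoissonVoids.semigroup_add (hS : HasPoissonVoids lam S P) (hf : IsBoundedLocal f)
    {s t : ℝ} (hs : 0 ≤ s) (ht : 0 ≤ t) :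
    semigroup P S (s + t) f = semigroup P S s (semigroup P S t f) := by
  funext η
  have hst : 0 ≤ s + t := add_nonneg hs ht
  have hmeas : Measurable fun S' : Conf (Space d × ℝ) => f (evolve (s + t) S' η) :=
    hf.measurable.comp (measurable_evolve_comp hst measurable_id measurable_const)
  have hc := hS.concat s
  calc semigroup P S (s + t) f η
      = ∫ S', f (evolve (s + t) S' η) ∂(P.map S) :=
        (integral_map hS.measurable.aemeasurable hmeas.aestronglyMeasurable).symm
    _ = ∫ q, f (evolve (s + t) (PoissonTree.concat s (S q.1) (S q.2)) η) ∂(P.prod P) := by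
        rw [hS.map_eq hc]
        exact integral_map hc.measurable.aemeasurable hmeas.aestronglyMeasurable
    _ = ∫ q, f (evolve t (S q.2) (evolve s (S q.1) η)) ∂(P.prod P) := by
        refine integral_congr_ae ?_
        have h0 : ∀ᵐ q ∂(P.prod P), ∀ p ∈ (S q.2).1, p.2 ≠ 0 :=
          Measure.quasiMeasurePreserving_snd.ae (hS.ae_time_ne 0)
        filter_upwards [h0] with q hq
        rw [evolve_concat hs ht _ _ hq]
    _ = ∫ ω, ∫ ω', f (evolve t (S ω') (evolve s (S ω) η)) ∂P ∂P := by
        refine integral_prod (f := fun q : Ω × Ω => f (evolve t (S q.2) (evolve s (S q.1) η))) ?_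
        exact hf.integrable_comp (measurable_evolve_comp ht (hS.measurable.comp measurable_snd)
          (measurable_evolve_comp hs (hS.measurable.comp measurable_fst) measurable_const))
    _ = semigroup P S s (semigroup P S t f) η := rfl

lemma HasPoissonVoids.isProbabilityMeasure_stationaryState (hS : HasPoissonVoids lam S P)
    (hlam : 0 < lam) : IsProbabilityMeasure (stationaryState P S) := by
  rw [hS.stationaryState_eq hlam]
  exact Measure.isProbabilityMeasure_map ((measurable_pastProcess 0).comp hS.measurable).aemeasurable

/-- The time shift realises the stationary state as the process at time `t` driven by the same `S`
as `semigroup P S t f`. This is the coupling. -/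
lemma HasPoissonVoids.integral_stationaryState (hS : HasPoissonVoids lam S P) (hlam : 0 < lam)
    (hf : IsBoundedLocal f) (t : ℝ) :
    ∫ ξ, f ξ ∂(stationaryState P S) = ∫ ω, f (pastProcess 0 (PoissonTree.timeShift t (S ω))) ∂P := by
  have hm : Measurable fun S' : Conf (Space d × ℝ) => f (pastProcess 0 S') :=
    hf.measurable.comp (measurable_pastProcess 0)
  have hp : Measurable fun ω => pastProcess 0 (S ω) :=
    (measurable_pastProcess 0).comp hS.measurable
  rw [hS.stationaryState_eq hlam, integral_map hp.aemeasurable hf.measurable.aestronglyMeasurable,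
    ← integral_map (f := fun S' => f (pastProcess 0 S')) hS.measurable.aemeasurable
      hm.aestronglyMeasurable, hS.map_eq (hS.timeShift t),
    integral_map (hS.timeShift t).measurable.aemeasurable hm.aestronglyMeasurable]

/-- Exponential convergence to the stationary state, with explicit constants. -/
lemma HasPoissonVoids.abs_semigroup_sub_le (hS : HasPoissonVoids lam S P) (hlam : 0 < lam)
    (hf : IsBoundedLocal f) {M : ℝ} (hM : ∀ η, |f η| ≤ M) {Λ : Set (Space d)}
    (hΛ : ∀ η ξ : Conf (Space d), η.1 ∩ Λ = ξ.1 ∩ Λ → f η = f ξ) {I : Finset ℕ}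
    (hI : ∀ x ∈ Λ, ∃ i ∈ I,
      x ∈ Metric.closedBall (TopologicalSpace.denseSeq (Space d) i) (1 / 2))
    {t : ℝ} (ht : 0 ≤ t) (η : Conf (Space d)) :
    |semigroup P S t f η - ∫ ξ, f ξ ∂(stationaryState P S)|
      ≤ 2 * M * I.card * Real.exp (-(halfBallVolume d * lam * t)) := by
  rw [hS.integral_stationaryState hlam hf t, semigroup_eq, mul_assoc]
  refine abs_integral_sub_le_of_eq_off
    (hf.integrable_comp (measurable_evolve_comp ht hS.measurable measurable_const))
    (hf.integrable_comp ((measurable_pastProcess 0).comp (hS.timeShift t).measurable))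
    (by linarith [(abs_nonneg _).trans (hM η)]) (by positivity) (fun ω => ?_) ?_
    (hS.prob_not_covered hI ht)
  · exact (abs_sub _ _).trans ((add_le_add (hM _) (hM _)).trans (two_mul M).ge)
  · filter_upwards [(hS.timeShift t).ae_everywhereHit hlam 0] with ω hω hcov
    have hcov : ∀ y ∈ Λ, Covered (S ω).1 y 0 t := not_not.1 hcov
    refine hΛ _ _ ?_
    have hp : (pastProcess 0 (PoissonTree.timeShift t (S ω))).1 = processAt (S ω).1 t := by
      rw [pastProcess_eq hω, Conf.ofSet_val (processAt_locallyFinite _ hω), processAt_timeShift,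
        zero_add]
    change _ = (pastProcess 0 (PoissonTree.timeShift t (S ω))).1 ∩ Λ
    rw [hp]
    ext y
    simp only [Set.mem_inter_iff]
    exact and_congr_left fun hy => mem_evolve_iff_mem_processAt ht (S ω) η (hcov y hy)

lemma IsBoundedLocal.exists_bounds (hf : IsBoundedLocal f) :
    ∃ (M : ℝ) (Λ : Set (Space d)) (I : Finset ℕ), (∀ η, |f η| ≤ M) ∧
      (∀ η ξ : Conf (Space d), η.1 ∩ Λ = ξ.1 ∩ Λ → f η = f ξ) ∧
      ∀ x ∈ Λ, ∃ i ∈ I, x ∈ Metric.closedBall (TopologicalSpace.denseSeq (Space d) i) (1 / 2) := by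
  obtain ⟨M, hM⟩ := hf.bounded
  obtain ⟨Λ, hΛ, h⟩ := hf.finite_support
  obtain ⟨I, hI⟩ := exists_finset_cover hΛ
  exact ⟨M, Λ, I, hM, h, hI⟩

lemma HasPoissonVoids.tendstoUniformly_semigroup (hS : HasPoissonVoids lam S P) (hlam : 0 < lam)
    (hf : IsBoundedLocal f) :
    TendstoUniformly (fun t => semigroup P S t f) (fun _ => ∫ ξ, f ξ ∂(stationaryState P S)) atTop := by
  obtain ⟨M, Λ, I, hM, hΛ, hI⟩ := hf.exists_bounds
  have hlim : Tendsto (fun t => 2 * M * I.card * Real.exp (-(halfBallVolume d * lam * t)))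
      atTop (𝓝 0) := by
    rw [← mul_zero (2 * M * I.card)]
    exact (Real.tendsto_exp_neg_atTop_nhds_zero.comp
      (tendsto_id.const_mul_atTop (mul_pos (halfBallVolume_pos d) hlam))).const_mul _
  rw [Metric.tendstoUniformly_iff]
  intro ε hε
  filter_upwards [hlim.eventually (gt_mem_nhds hε), eventually_ge_atTop 0] with t ht ht0 η
  rw [dist_comm, Real.dist_eq]
  exact (hS.abs_semigroup_sub_le hlam hf hM hΛ hI ht0 η).trans_lt ht

lemma integral_tendsto_of_tendstoUniformly {α : Type*} [MeasurableSpace α] {μ : Measure α}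
    [IsProbabilityMeasure μ] {F : ℝ → α → ℝ} {c : ℝ} (hF : ∀ t, 0 ≤ t → Integrable (F t) μ)
    (h : TendstoUniformly F (fun _ => c) atTop) :
    Tendsto (fun t => ∫ a, F t a ∂μ) atTop (𝓝 c) := by
  rw [Metric.tendsto_nhds]
  intro ε hε
  filter_upwards [Metric.tendstoUniformly_iff.1 h (ε / 2) (half_pos hε),
    eventually_ge_atTop 0] with t ht ht0
  have h1 : ∫ a, F t a ∂μ - c = ∫ a, (F t a - c) ∂μ := by
    rw [integral_sub (hF t ht0) (integrable_const c)]
    simp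
  rw [Real.dist_eq, h1, ← Real.norm_eq_abs]
  have := norm_integral_le_of_norm_le_const (μ := μ) (f := fun a => F t a - c) (C := ε / 2)
    (Eventually.of_forall fun a => by
      have := ht a
      rw [dist_comm, Real.dist_eq] at this
      exact this.le)
  simp only [probReal_univ, mul_one] at this
  linarith

/-- As `s → ∞`, `P_s (P_t f)` tends to the stationary mean of `P_t f`, while the same quantity
`P_{s+t} f` tends to that of `f`. -/
lemma HasPoissonVoids.isStationary (hS : HasPoissonVoids lam S P) (hlam : 0 < lam) :
    IsStationary (semigroup P S) (stationaryState P S) := by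
  refine ⟨hS.isProbabilityMeasure_stationaryState hlam, fun f hf t ht => ?_⟩
  have hft := hf.semigroup (P := P) hS.measurable ht
  obtain ⟨η⟩ : Nonempty (Conf (Space d)) := ⟨Conf.ofSet ∅⟩
  refine tendsto_nhds_unique ((hS.tendstoUniformly_semigroup hlam hft).tendsto_at η) ?_
  have h2 := ((hS.tendstoUniformly_semigroup hlam hf).tendsto_at η).comp
    (tendsto_atTop_add_const_right _ t tendsto_id)
  refine h2.congr' ?_
  filter_upwards [eventually_ge_atTop 0] with s hs
  exact congrFun (hS.semigroup_add hf hs ht) η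

lemma isBoundedLocal_void {A : Set (Space d)} (hA : MeasurableSet A) (hA' : IsBounded A) :
    IsBoundedLocal ({η : Conf (Space d) | η.1 ∩ A = ∅}.indicator fun _ => (1 : ℝ)) := by
  refine ⟨measurable_const.indicator (Conf.measurableSet_void hA), ⟨1, fun η => ?_⟩, A, hA',
    fun η ξ h => ?_⟩
  · by_cases h : η.1 ∩ A = ∅
    · rw [Set.indicator_of_mem (by exact h)]
      simp
    · rw [Set.indicator_of_notMem (by exact h)]
      simp
  · simp only [Set.indicator, Set.mem_ofPred_eq, h]

/-- Under an invariant `μ` the mean of `P_t f` is constant in `t`, and uniform convergence sends it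
to the stationary mean of `f`. Indicators of void events are local, and they determine the measure.
-/
lemma HasPoissonVoids.stationary_unique (hS : HasPoissonVoids lam S P) (hlam : 0 < lam)
    {μ : Measure (Conf (Space d))} (hμ : IsStationary (semigroup P S) μ) :
    μ = stationaryState P S := by
  have := hμ.isProbabilityMeasure
  have := hS.isProbabilityMeasure_stationaryState hlam
  refine Conf.measure_ext fun A hA hA' => ?_
  have hf := isBoundedLocal_void hA hA'
  have hlim := integral_tendsto_of_tendstoUniformly (μ := μ)
    (fun t ht => (hf.semigroup (P := P) hS.measurable ht).integrable_comp measurable_id)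
    (hS.tendstoUniformly_semigroup hlam hf)
  have heq : ∫ η, {η : Conf (Space d) | η.1 ∩ A = ∅}.indicator (fun _ => (1 : ℝ)) η ∂μ
      = ∫ ξ, {η : Conf (Space d) | η.1 ∩ A = ∅}.indicator (fun _ => (1 : ℝ)) ξ
        ∂(stationaryState P S) := by
    refine tendsto_nhds_unique (tendsto_const_nhds.congr' ?_) hlim
    filter_upwards [eventually_ge_atTop 0] with t ht
    exact (hμ.invariant _ hf t ht).symm
  rw [integral_indicator_const _ (Conf.measurableSet_void hA),
    integral_indicator_const _ (Conf.measurableSet_void hA), smul_eq_mul, smul_eq_mul, mul_one,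
    mul_one] at heq
  exact (measureReal_eq_measureReal_iff).1 heq

end Semigroup

/-! ### Small time intervals: at most one obstacle near the support -/

section Generator

variable {d : ℕ}

/-- The configuration `S` has exactly one point in `A`. -/
def HasUniquePoint (S A : Set (Space d × ℝ)) : Prop := ∃ p, S ∩ A = {p}

open Classical in
/-- The position of the only point of `S` in `A`; `0` if there is no such point. -/
noncomputable def uniquePosition (S A : Set (Space d × ℝ)) : Space d :=
  if h : HasUniquePoint S A then h.choose.1 else 0

lemma uniquePosition_eq {S A : Set (Space d × ℝ)} {p : Space d × ℝ} (h : S ∩ A = {p}) :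
    uniquePosition S A = p.1 := by
  have h' : HasUniquePoint S A := ⟨p, h⟩
  have hp : h'.choose = p := Set.singleton_injective (h'.choose_spec.symm.trans h)
  unfold uniquePosition
  rw [dif_pos h', hp]

/-- This turns the location of the point into counts on two disjoint sets, which gives both its
measurability and, through independence of counts, its law. -/
lemma uniquePosition_mem_iff {S : Set (Space d × ℝ)} {W B : Set (Space d)} {I : Set ℝ} :
    HasUniquePoint S (W ×ˢ I) ∧ uniquePosition S (W ×ˢ I) ∈ B ↔
      HasUniquePoint S ((W ∩ B) ×ˢ I) ∧ S ∩ ((W \ B) ×ˢ I) = ∅ := by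
  have hun : S ∩ (W ×ˢ I) = S ∩ ((W ∩ B) ×ˢ I) ∪ S ∩ ((W \ B) ×ˢ I) := by
    rw [← Set.inter_union_distrib_left, ← Set.union_prod, Set.inter_union_sdiff]
  constructor
  · rintro ⟨⟨p, hp⟩, hB⟩
    rw [uniquePosition_eq hp] at hB
    have hpm : p ∈ S ∩ (W ×ˢ I) := hp ▸ Set.mem_singleton p
    have hempty : S ∩ ((W \ B) ×ˢ I) = ∅ := by
      refine Set.eq_empty_iff_forall_notMem.2 fun q hq => hq.2.1.2 ?_
      have : q ∈ ({p} : Set _) := hp ▸ hun ▸ Or.inr hq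
      rw [Set.mem_singleton_iff.1 this]
      exact hB
    rw [hempty, Set.union_empty] at hun
    exact ⟨⟨p, hun ▸ hp⟩, hempty⟩
  · rintro ⟨⟨p, hp⟩, hempty⟩
    rw [hempty, Set.union_empty, hp] at hun
    refine ⟨⟨p, hun⟩, ?_⟩
    rw [uniquePosition_eq hun]
    have : p ∈ S ∩ ((W ∩ B) ×ˢ I) := hp ▸ Set.mem_singleton p
    exact this.2.1.2

lemma measurableSet_hasUniquePoint {A : Set (Space d × ℝ)} (hA : MeasurableSet A) :
    MeasurableSet {S : Conf (Space d × ℝ) | HasUniquePoint S.1 A} := by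
  convert Conf.measurable_encard hA (measurableSet_singleton 1) using 1
  ext S
  simp [HasUniquePoint, Set.encard_eq_one]

lemma measurable_uniquePosition {W : Set (Space d)} {I : Set ℝ} (hW : MeasurableSet W)
    (hI : MeasurableSet I) :
    Measurable fun S : Conf (Space d × ℝ) => uniquePosition S.1 (W ×ˢ I) := by
  intro B hB
  have h1 := (measurableSet_hasUniquePoint ((hW.inter hB).prod hI)).inter
    (Conf.measurableSet_void ((hW.diff hB).prod hI))
  -- Without a unique point the position is 0 by default, so this part of the preimage is everything
  -- or nothing.
  have h2 := (measurableSet_hasUniquePoint (hW.prod hI)).compl.inter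
    (MeasurableSet.const ((0 : Space d) ∈ B))
  convert h1.union h2 using 1
  ext S
  have hiff := uniquePosition_mem_iff (S := S.1) (W := W) (B := B) (I := I)
  by_cases h : HasUniquePoint S.1 (W ×ˢ I)
  · simp only [h, true_and] at hiff
    simp [hiff, h]
  · have h0 : uniquePosition S.1 (W ×ˢ I) = 0 := dif_neg h
    simp only [h, false_and, false_iff] at hiff
    simp only [Set.mem_preimage, h0, Set.mem_union, Set.mem_inter_iff, Set.mem_ofPred_eq,
      Set.mem_compl_iff, h, not_false_eq_true, true_and]
    tauto

section Local

variable {S : Conf (Space d × ℝ)} {Λ W : Set (Space d)} {h : ℝ}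

/-- `W` contains the unit neighbourhood of `Λ`, so obstacles centred outside `W` cannot touch `Λ`.
-/
lemma covered_iff_of_inter_eq (hW : ∀ y ∈ Λ, ∀ u, dist y u ≤ 1 → u ∈ W)
    {a : ℝ} (ha : 0 ≤ a) {y : Space d} (hy : y ∈ Λ) :
    Covered S.1 y a h ↔ ∃ p ∈ S.1 ∩ (W ×ˢ Set.Ioc 0 h), a < p.2 ∧ dist y p.1 ≤ 1 := by
  constructor
  · rintro ⟨p, hp, h1, h2, h3⟩
    exact ⟨p, ⟨hp, hW y hy _ h3, ha.trans_lt h1, h2⟩, h1, h3⟩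
  · rintro ⟨p, ⟨hp, -, hpI⟩, h1, h3⟩
    exact ⟨p, hp, h1, hpI.2, h3⟩

lemma mem_evolve_local (h0 : ∀ p ∈ S.1, p.2 ≠ 0) (hh : 0 ≤ h)
    (hW : ∀ y ∈ Λ, ∀ u, dist y u ≤ 1 → u ∈ W) (η : Conf (Space d)) {y : Space d} (hy : y ∈ Λ) :
    y ∈ (evolve h S η).1 ↔ (y ∈ η.1 ∧ ¬ Covered S.1 y 0 h) ∨
      ∃ r, (y, r) ∈ S.1 ∩ (W ×ˢ Set.Ioc 0 h) ∧ ¬ Covered S.1 y r h := by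
  rw [mem_evolve hh]
  refine or_congr_right (exists_congr fun r => ?_)
  constructor
  · rintro ⟨h1, h2, h3, h4⟩
    exact ⟨⟨h1, hW y hy y (by simp), lt_of_le_of_ne h2 (h0 _ h1).symm, h3⟩, h4⟩
  · rintro ⟨⟨h1, -, h2, h3⟩, h4⟩
    exact ⟨h1, h2.le, h3, h4⟩

lemma evolve_inter_eq_of_empty (h0 : ∀ p ∈ S.1, p.2 ≠ 0) (hh : 0 ≤ h)
    (hW : ∀ y ∈ Λ, ∀ u, dist y u ≤ 1 → u ∈ W) (hS : S.1 ∩ (W ×ˢ Set.Ioc 0 h) = ∅)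
    (η : Conf (Space d)) : (evolve h S η).1 ∩ Λ = η.1 ∩ Λ := by
  ext y
  simp only [Set.mem_inter_iff]
  refine and_congr_left fun hy => ?_
  rw [mem_evolve_local h0 hh hW η hy, covered_iff_of_inter_eq hW le_rfl hy, hS]
  simp

lemma evolve_inter_eq_of_singleton (h0 : ∀ p ∈ S.1, p.2 ≠ 0) (hh : 0 ≤ h)
    (hW : ∀ y ∈ Λ, ∀ u, dist y u ≤ 1 → u ∈ W) {p : Space d × ℝ}
    (hS : S.1 ∩ (W ×ˢ Set.Ioc 0 h) = {p})
    (η : Conf (Space d)) : (evolve h S η).1 ∩ Λ = (update η p.1).1 ∩ Λ := by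
  have hp : p ∈ S.1 ∩ (W ×ˢ Set.Ioc 0 h) := hS ▸ Set.mem_singleton p
  ext y
  simp only [Set.mem_inter_iff]
  refine and_congr_left fun hy => ?_
  have hc : ∀ a, 0 ≤ a → (Covered S.1 y a h ↔ a < p.2 ∧ dist y p.1 ≤ 1) := fun a ha => by
    rw [covered_iff_of_inter_eq hW ha hy, hS]
    simp
  rw [mem_evolve_local h0 hh hW η hy, mem_update, hc 0 le_rfl, hS]
  have hp0 : 0 < p.2 := hp.2.2.1
  constructor
  · rintro (⟨h1, h2⟩ | ⟨r, hr, -⟩)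
    · exact Or.inl ⟨h1, fun h3 => h2 ⟨hp0, h3⟩⟩
    · exact Or.inr (congrArg Prod.fst (Set.mem_singleton_iff.1 hr))
  · rintro (⟨h1, h2⟩ | rfl)
    · exact Or.inl ⟨h1, fun h3 => h2 h3.2⟩
    · refine Or.inr ⟨p.2, rfl, ?_⟩
      -- The obstacle does not remove its own centre, since covering counts only times strictly
      -- after birth.
      rw [hc _ hp0.le]
      exact fun h3 => lt_irrefl _ h3.1

lemma update_inter_eq_of_notMem (hW : ∀ y ∈ Λ, ∀ u, dist y u ≤ 1 → u ∈ W) (η : Conf (Space d))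
    {u : Space d} (hu : u ∉ W) : (update η u).1 ∩ Λ = η.1 ∩ Λ := by
  ext y
  simp only [Set.mem_inter_iff]
  refine and_congr_left fun hy => ?_
  rw [mem_update]
  constructor
  · rintro (h1 | rfl)
    · exact h1.1
    · exact absurd (hW y hy y (by simp)) hu
  · exact fun h1 => Or.inl ⟨h1, fun h2 => hu (hW y hy u h2)⟩

end Local

variable {Ω : Type*} [MeasurableSpace Ω] {P : Measure Ω} {lam : ℝ} {S : Ω → Conf (Space d × ℝ)}

lemma measurable_ncard_inter (hS : Measurable S) {A : Set (Space d × ℝ)} (hA : MeasurableSet A) :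
    Measurable fun ω => ((S ω).1 ∩ A).ncard :=
  (measurable_of_countable ENat.toNat).comp ((Conf.measurable_encard hA).comp hS)

lemma hasUniquePoint_iff_ncard {S A : Set (Space d × ℝ)} :
    HasUniquePoint S A ↔ (S ∩ A).ncard = 1 := Set.ncard_eq_one.symm

lemma IsPoissonProcess.prob_hasUniquePoint (hS : IsPoissonProcess lam S P) (hlam : 0 ≤ lam)
    {A : Set (Space d × ℝ)} (hA : MeasurableSet A) (hA' : IsBounded A) :
    P {ω | HasUniquePoint (S ω).1 A} = ENNReal.ofReal
      (Real.exp (-(lam * (volume A).toReal)) * (lam * (volume A).toReal)) := by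
  have h := congrArg (fun μ => μ {1}) (hS.law_count A hA hA')
  rw [Measure.map_apply (measurable_ncard_inter hS.measurable hA) (measurableSet_singleton 1),
    poissonMeasure_singleton] at h
  convert h using 2
  · ext ω
    exact hasUniquePoint_iff_ncard
  · simp only [NNReal.coe_mul, Real.coe_toNNReal _ hlam, ENNReal.coe_toNNReal_eq_toReal, pow_one,
      Nat.factorial_one, Nat.cast_one, div_one]

lemma IsPoissonProcess.prob_hasUniquePoint_and_void (hS : IsPoissonProcess lam S P)
    (hlam : 0 ≤ lam) {A B : Set (Space d × ℝ)} (hA : MeasurableSet A) (hA' : IsBounded A)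
    (hB : MeasurableSet B) (hB' : IsBounded B) (hAB : Disjoint A B) :
    P {ω | HasUniquePoint (S ω).1 A ∧ (S ω).1 ∩ B = ∅} = ENNReal.ofReal
      (Real.exp (-(lam * (volume A).toReal)) * (lam * (volume A).toReal))
        * ENNReal.ofReal (Real.exp (-(lam * (volume B).toReal))) := by
  have hind := hS.indep_count 2 ![A, B] (by simp [Fin.forall_fin_two, hA, hB])
    (by simp [Fin.forall_fin_two, hA', hB']) (by
      intro i j hij
      fin_cases i <;> fin_cases j <;> simp_all [disjoint_comm])
  have h := (hind.indepFun (show (0 : Fin 2) ≠ 1 by decide)).measure_inter_preimage_eq_mul {1} {0}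
    (measurableSet_singleton _) (measurableSet_singleton _)
  rw [← hS.prob_hasUniquePoint hlam hA hA', ← hS.void_prob hlam hB hB']
  convert h using 2
  · ext ω
    simp [hasUniquePoint_iff_ncard, Set.ncard_eq_zero ((S ω).finite_inter hB')]
  · congr 1
    ext ω
    simp [hasUniquePoint_iff_ncard]
  · congr 1
    ext ω
    simp [Set.ncard_eq_zero ((S ω).finite_inter hB')]

/-- Given that there is exactly one point in `W × (0, h]`, its position is uniform on `W`. -/
lemma IsPoissonProcess.map_uniquePosition (hS : IsPoissonProcess lam S P) (hlam : 0 ≤ lam)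
    {W : Set (Space d)} (hW : MeasurableSet W) (hW' : IsBounded W) {h : ℝ} (hh : 0 ≤ h) :
    (P.restrict {ω | HasUniquePoint (S ω).1 (W ×ˢ Set.Ioc 0 h)}).map
        (fun ω => uniquePosition (S ω).1 (W ×ˢ Set.Ioc 0 h))
      = ENNReal.ofReal (lam * h * Real.exp (-(lam * h * (volume W).toReal)))
        • volume.restrict W := by
  have hvol : ∀ B : Set (Space d), (volume (B ×ˢ Set.Ioc 0 h)).toReal = (volume B).toReal * h := by
    intro B
    rw [Measure.volume_eq_prod, Measure.prod_prod, Real.volume_Ioc, sub_zero, ENNReal.toReal_mul,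
      ENNReal.toReal_ofReal hh]
  have hb : ∀ B : Set (Space d), B ⊆ W → IsBounded (B ×ˢ Set.Ioc 0 h) := fun B hB =>
    (hW'.subset hB).prod (Metric.isBounded_Ioc _ _)
  have hUm : Measurable fun ω => uniquePosition (S ω).1 (W ×ˢ Set.Ioc 0 h) :=
    (measurable_uniquePosition hW measurableSet_Ioc).comp hS.measurable
  ext B hB
  rw [Measure.map_apply hUm hB, Measure.restrict_apply (hUm hB), Measure.smul_apply,
    Measure.restrict_apply hB, smul_eq_mul]
  have hset : (fun ω => uniquePosition (S ω).1 (W ×ˢ Set.Ioc 0 h)) ⁻¹' B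
      ∩ {ω | HasUniquePoint (S ω).1 (W ×ˢ Set.Ioc 0 h)}
      = {ω | HasUniquePoint (S ω).1 ((W ∩ B) ×ˢ Set.Ioc 0 h) ∧
        (S ω).1 ∩ ((W \ B) ×ˢ Set.Ioc 0 h) = ∅} := by
    ext ω
    exact and_comm.trans uniquePosition_mem_iff
  have hsplit : (volume W).toReal = (volume (W ∩ B)).toReal + (volume (W \ B)).toReal := by
    rw [← ENNReal.toReal_add (hW'.subset Set.inter_subset_left).measure_lt_top.ne
      (hW'.subset Set.sdiff_subset).measure_lt_top.ne, measure_inter_add_sdiff _ hB]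
  rw [hset, hS.prob_hasUniquePoint_and_void hlam ((hW.inter hB).prod measurableSet_Ioc)
    (hb _ Set.inter_subset_left) ((hW.diff hB).prod measurableSet_Ioc) (hb _ Set.sdiff_subset)
    (Set.disjoint_prod.2 (Or.inl (Set.disjoint_sdiff_inter.symm))), hvol, hvol,
    ← ENNReal.ofReal_mul (by positivity), Set.inter_comm B W,
    ← ENNReal.ofReal_toReal (hW'.subset (Set.inter_subset_left (t := B))).measure_lt_top.ne,
    ← ENNReal.ofReal_mul (by positivity), hsplit,
    ENNReal.toReal_ofReal ENNReal.toReal_nonneg]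
  -- The two exponentials merge into a factor depending on `W` alone, leaving only the volume of `W
  -- ∩ B`: this is uniformity.
  congr 1
  rw [mul_add, neg_add, Real.exp_add]
  ring_nf

lemma IsPoissonProcess.prob_two_points_le [IsProbabilityMeasure P] (hS : IsPoissonProcess lam S P)
    (hlam : 0 ≤ lam) {A : Set (Space d × ℝ)} (hA : MeasurableSet A) (hA' : IsBounded A) :
    P {ω | ¬ ((S ω).1 ∩ A = ∅ ∨ HasUniquePoint (S ω).1 A)}
      ≤ ENNReal.ofReal ((lam * (volume A).toReal) ^ 2) := by
  set m := lam * (volume A).toReal with hm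
  have hm0 : 0 ≤ m := by positivity
  have h1 := hS.void_prob hlam hA hA'
  have h2 := hS.prob_hasUniquePoint hlam hA hA'
  rw [← hm] at h1 h2
  have hm1 : MeasurableSet {ω | (S ω).1 ∩ A = ∅} := hS.measurable (Conf.measurableSet_void hA)
  have hm2 : MeasurableSet {ω | HasUniquePoint (S ω).1 A} :=
    hS.measurable (measurableSet_hasUniquePoint hA)
  have hd : Disjoint {ω | (S ω).1 ∩ A = ∅} {ω | HasUniquePoint (S ω).1 A} := by
    refine Set.disjoint_left.2 fun ω (hω : _ = _) ⟨p, hp⟩ => ?_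
    rw [hω] at hp
    exact Set.singleton_ne_empty p hp.symm
  have hset : {ω | ¬ ((S ω).1 ∩ A = ∅ ∨ HasUniquePoint (S ω).1 A)}
      = ({ω | (S ω).1 ∩ A = ∅} ∪ {ω | HasUniquePoint (S ω).1 A})ᶜ := rfl
  rw [hset, prob_compl_eq_one_sub (hm1.union hm2), measure_union hd hm2, h1, h2,
    ← ENNReal.ofReal_add (by positivity) (by positivity), ← ENNReal.ofReal_one,
    ← ENNReal.ofReal_sub _ (by positivity)]
  refine ENNReal.ofReal_le_ofReal ?_
  -- The probability is 1 - (1 + m) exp(-m), and exp(-m) ≥ 1 - m bounds it by 1 - (1 + m)(1 - m) =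
  -- m^2.
  have := Real.add_one_le_exp (-m)
  nlinarith

end Generator

/-! ### The derivative of the semigroup at time zero -/

section Derivative

variable {d : ℕ} {Ω : Type*} [MeasurableSpace Ω] {P : Measure Ω} [IsProbabilityMeasure P]
  {lam : ℝ} {S : Ω → Conf (Space d × ℝ)} {f : Conf (Space d) → ℝ}

/-- The first-order expansion of the semigroup, with one obstacle in `W × (0, h]`. -/
lemma IsPoissonProcess.integral_single_update (hS : IsPoissonProcess lam S P) (hlam : 0 ≤ lam)
    (hf : IsBoundedLocal f) {W : Set (Space d)} (hW : MeasurableSet W) (hW' : IsBounded W)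
    {h : ℝ} (hh : 0 ≤ h) (η : Conf (Space d)) (hη : ∀ u, u ∉ W → f (update η u) = f η) :
    Integrable (fun ω => f η + {ω | HasUniquePoint (S ω).1 (W ×ˢ Set.Ioc 0 h)}.indicator
        (fun ω => f (update η (uniquePosition (S ω).1 (W ×ˢ Set.Ioc 0 h))) - f η) ω) P ∧
      ∫ ω, (f η + {ω | HasUniquePoint (S ω).1 (W ×ˢ Set.Ioc 0 h)}.indicator
        (fun ω => f (update η (uniquePosition (S ω).1 (W ×ˢ Set.Ioc 0 h))) - f η) ω) ∂P
      = f η + lam * h * Real.exp (-(lam * h * (volume W).toReal))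
        * ∫ u, (f (update η u) - f η) := by
  have hE : MeasurableSet {ω | HasUniquePoint (S ω).1 (W ×ˢ Set.Ioc 0 h)} :=
    hS.measurable (measurableSet_hasUniquePoint (hW.prod measurableSet_Ioc))
  have hU : Measurable fun ω => uniquePosition (S ω).1 (W ×ˢ Set.Ioc 0 h) :=
    (measurable_uniquePosition hW measurableSet_Ioc).comp hS.measurable
  have hg : Measurable fun u => f (update η u) - f η :=
    (hf.measurable.comp (measurable_update η)).sub_const _
  have hint : Integrable ({ω | HasUniquePoint (S ω).1 (W ×ˢ Set.Ioc 0 h)}.indicator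
      (fun ω => f (update η (uniquePosition (S ω).1 (W ×ˢ Set.Ioc 0 h))) - f η)) P :=
    ((hf.integrable_comp ((measurable_update η).comp hU)).sub (integrable_const _)).indicator hE
  refine ⟨(integrable_const _).add hint, ?_⟩
  rw [integral_add (integrable_const _) hint, integral_indicator hE,
    ← integral_map (f := fun u => f (update η u) - f η) hU.aemeasurable hg.aestronglyMeasurable,
    hS.map_uniquePosition hlam hW hW' hh, integral_smul_measure,
    setIntegral_eq_integral_of_forall_compl_eq_zero (fun u hu => by rw [hη u hu, sub_self]),
    ENNReal.toReal_ofReal (by positivity)]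
  simp

/-- With `v` the volume of `W`, two errors of size 2M (lam v)^2 h add up. One comes from replacing
the process by a single update, wrong only when `W × (0, h]` has at least two points; the other from
replacing the factor exp(-lam h v) by 1. Neither depends on `η`. -/
lemma IsPoissonProcess.abs_semigroup_sub_generator_le (hS : IsPoissonProcess lam S P)
    (hlam : 0 ≤ lam) (hf : IsBoundedLocal f) {M : ℝ} (hM : ∀ η, |f η| ≤ M) {Λ W : Set (Space d)}
    (hΛ : ∀ η ξ : Conf (Space d), η.1 ∩ Λ = ξ.1 ∩ Λ → f η = f ξ) (hW : MeasurableSet W)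
    (hW' : IsBounded W) (hΛW : ∀ y ∈ Λ, ∀ u, dist y u ≤ 1 → u ∈ W) {h : ℝ} (hh : 0 < h)
    (η : Conf (Space d)) :
    |(semigroup P S h f η - f η) / h - generator lam f η|
      ≤ 4 * M * (lam * (volume W).toReal) ^ 2 * h := by
  set v := (volume W).toReal with hv
  have hv0 : 0 ≤ v := ENNReal.toReal_nonneg
  have hM0 : 0 ≤ M := (abs_nonneg _).trans (hM η)
  have hη : ∀ u, u ∉ W → f (update η u) = f η := fun u hu =>
    hΛ _ _ (update_inter_eq_of_notMem hΛW η hu)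
  obtain ⟨hGi, hG⟩ := hS.integral_single_update hlam hf hW hW' hh.le η hη
  set G := fun ω => f η + {ω | HasUniquePoint (S ω).1 (W ×ˢ Set.Ioc 0 h)}.indicator
    (fun ω => f (update η (uniquePosition (S ω).1 (W ×ˢ Set.Ioc 0 h))) - f η) ω with hGdef
  have hGM : ∀ ω, |G ω| ≤ M := by
    intro ω
    rw [hGdef]
    by_cases h1 : ω ∈ {ω | HasUniquePoint (S ω).1 (W ×ˢ Set.Ioc 0 h)}
    · simpa [Set.indicator_of_mem h1] using hM _
    · simpa [Set.indicator_of_notMem h1] using hM _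
  have hvol : (volume (W ×ˢ Set.Ioc 0 h)).toReal = v * h := by
    rw [Measure.volume_eq_prod, Measure.prod_prod, Real.volume_Ioc, sub_zero, ENNReal.toReal_mul,
      ENNReal.toReal_ofReal hh.le]
  have hp := hS.prob_two_points_le hlam (hW.prod measurableSet_Ioc)
    (hW'.prod (Metric.isBounded_Ioc 0 h))
  rw [hvol] at hp
  have h1 : |semigroup P S h f η - ∫ ω, G ω ∂P| ≤ 2 * M * (lam * (v * h)) ^ 2 := by
    refine abs_integral_sub_le_of_eq_off
      (hf.integrable_comp (measurable_evolve_comp hh.le hS.measurable measurable_const)) hGi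
      (by positivity) (by positivity)
      (fun ω => (abs_sub _ _).trans ((add_le_add (hM _) (hGM _)).trans (two_mul M).ge)) ?_ hp
    filter_upwards [(hS.hasPoissonVoids hlam).ae_time_ne 0] with ω h0 hω
    rcases not_not.1 hω with hω | ⟨p, hω⟩
    · have hn : ω ∉ {ω | HasUniquePoint (S ω).1 (W ×ˢ Set.Ioc 0 h)} := by
        rintro ⟨p, hp⟩
        exact Set.singleton_ne_empty p (hp.symm.trans hω)
      rw [hGdef]
      simp only [Set.indicator_of_notMem hn, add_zero]
      exact hΛ _ _ (evolve_inter_eq_of_empty h0 hh.le hΛW hω η)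
    · have hn : ω ∈ {ω | HasUniquePoint (S ω).1 (W ×ˢ Set.Ioc 0 h)} := ⟨p, hω⟩
      rw [hGdef]
      simp only [Set.indicator_of_mem hn, add_sub_cancel]
      rw [uniquePosition_eq hω]
      exact hΛ _ _ (evolve_inter_eq_of_singleton h0 hh.le hΛW hω η)
  set J := ∫ u, (f (update η u) - f η) with hJ
  have hJb : |J| ≤ 2 * M * v := by
    rw [hJ, ← setIntegral_eq_integral_of_forall_compl_eq_zero (s := W)
      (fun u hu => by rw [hη u hu, sub_self])]
    refine norm_setIntegral_le_of_norm_le_const (μ := volume) (s := W) (C := 2 * M)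
      (f := fun u => f (update η u) - f η) hW'.measure_lt_top fun u _ => ?_
    rw [Real.norm_eq_abs]
    exact (abs_sub _ _).trans ((add_le_add (hM _) (hM _)).trans (two_mul M).ge)
  have hexp : |Real.exp (-(lam * h * v)) - 1| ≤ lam * h * v := by
    have h2 := Real.add_one_le_exp (-(lam * h * v))
    have h3 : Real.exp (-(lam * h * v)) ≤ 1 := Real.exp_le_one_iff.2 (by
      have : 0 ≤ lam * h * v := by positivity
      linarith)
    rw [abs_le]
    constructor <;> nlinarith [show 0 ≤ lam * h * v by positivity]
  have hdecomp : (semigroup P S h f η - f η) / h - generator lam f η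
      = (semigroup P S h f η - ∫ ω, G ω ∂P) / h
        + lam * (Real.exp (-(lam * h * v)) - 1) * J := by
    rw [hG, show generator lam f η = lam * J from rfl]
    field_simp
    ring
  rw [hdecomp]
  refine (abs_add_le _ _).trans ?_
  have h2 : |(semigroup P S h f η - ∫ ω, G ω ∂P) / h| ≤ 2 * M * (lam * v) ^ 2 * h := by
    rw [abs_div, abs_of_pos hh, div_le_iff₀ hh]
    refine h1.trans (le_of_eq ?_)
    ring
  have h3 : |lam * (Real.exp (-(lam * h * v)) - 1) * J| ≤ 2 * M * (lam * v) ^ 2 * h := by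
    rw [abs_mul, abs_mul, abs_of_nonneg hlam]
    calc lam * |Real.exp (-(lam * h * v)) - 1| * |J|
        ≤ lam * (lam * h * v) * (2 * M * v) := by gcongr
      _ = 2 * M * (lam * v) ^ 2 * h := by ring
  linarith

lemma IsPoissonProcess.tendstoUniformly_generator (hS : IsPoissonProcess lam S P)
    (hlam : 0 ≤ lam) (hf : IsBoundedLocal f) :
    TendstoUniformly (fun (h : ℝ) (η : Conf (Space d)) => (semigroup P S h f η - f η) / h)
      (generator lam f) (𝓝[>] 0) := by
  obtain ⟨M, hM⟩ := hf.bounded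
  obtain ⟨Λ, hΛ, hfΛ⟩ := hf.finite_support
  obtain ⟨R, hR⟩ := hΛ.subset_closedBall 0
  have hΛW : ∀ y ∈ Λ, ∀ u, dist y u ≤ 1 → u ∈ Metric.closedBall (0 : Space d) (R + 1) := by
    intro y hy u hu
    have h1 := Metric.mem_closedBall.1 (hR hy)
    rw [Metric.mem_closedBall]
    linarith [dist_triangle_left u 0 y]
  set c := 4 * M * (lam * (volume (Metric.closedBall (0 : Space d) (R + 1))).toReal) ^ 2
  have hlim : Tendsto (fun h : ℝ => c * h) (𝓝[>] 0) (𝓝 0) := by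
    have : Tendsto (fun h : ℝ => c * h) (𝓝 0) (𝓝 (c * 0)) := tendsto_id.const_mul c
    rw [mul_zero] at this
    exact this.mono_left nhdsWithin_le_nhds
  rw [Metric.tendstoUniformly_iff]
  intro ε hε
  filter_upwards [hlim.eventually (gt_mem_nhds hε), self_mem_nhdsWithin] with h hhε hh η
  rw [dist_comm, Real.dist_eq]
  exact (hS.abs_semigroup_sub_generator_le hlam hf hM hfΛ Metric.isClosed_closedBall.measurableSet
    Metric.isBounded_closedBall hΛW hh η).trans_lt hhε

lemma IsPoissonProcess.isSemigroupWithGenerator (hS : IsPoissonProcess lam S P)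
    (hlam : 0 ≤ lam) : IsSemigroupWithGenerator (semigroup P S) (generator lam) where
  maps_to _ hf _ ht := hf.semigroup hS.measurable ht
  zero f _ := (hS.hasPoissonVoids hlam).semigroup_zero f
  add _ hf _ _ hs ht := (hS.hasPoissonVoids hlam).semigroup_add hf hs ht
  deriv _ hf := hS.tendstoUniformly_generator hlam hf

end Derivative

end PoissonTree

theorem corollary4p2 (d : ℕ) (hd : 2 ≤ d) :
    ∃ Cd : ℝ, 0 < Cd ∧ ∃ C : (PoissonTree.Conf (PoissonTree.Space d) → ℝ) → ℝ,
      ∀ lam : ℝ, 0 < lam →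
      ∀ (Ω : Type*) [MeasurableSpace Ω] (P : Measure Ω) [IsProbabilityMeasure P]
        (S : Ω → PoissonTree.Conf (PoissonTree.Space d × ℝ)),
        PoissonTree.IsPoissonProcess lam S P →
          PoissonTree.IsSemigroupWithGenerator (PoissonTree.semigroup P S)
            (PoissonTree.generator lam) ∧
          PoissonTree.IsStationary (PoissonTree.semigroup P S)
            (PoissonTree.stationaryState P S) ∧
          (∀ μ : Measure (PoissonTree.Conf (PoissonTree.Space d)),
            PoissonTree.IsStationary (PoissonTree.semigroup P S) μ →
              μ = PoissonTree.stationaryState P S) ∧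
          ∀ f : PoissonTree.Conf (PoissonTree.Space d) → ℝ, PoissonTree.IsBoundedLocal f →
            ∀ t : ℝ, 0 ≤ t → ∀ η : PoissonTree.Conf (PoissonTree.Space d),
              |PoissonTree.semigroup P S t f η - ∫ ξ, f ξ ∂(PoissonTree.stationaryState P S)|
                ≤ C f * Real.exp (-(Cd * lam * t)) := by
  -- `C` must be fixed before the rate and the probability space, so it is chosen from a bound and a
  -- cover attached to `f` alone; 0 is a dummy value when `f` is not bounded and local.
  have hconst : ∀ f : PoissonTree.Conf (PoissonTree.Space d) → ℝ, ∃ c : ℝ,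
      PoissonTree.IsBoundedLocal f → ∃ (M : ℝ) (Λ : Set (PoissonTree.Space d)) (I : Finset ℕ),
        c = 2 * M * I.card ∧ (∀ η, |f η| ≤ M) ∧
        (∀ η ξ : PoissonTree.Conf (PoissonTree.Space d), η.1 ∩ Λ = ξ.1 ∩ Λ → f η = f ξ) ∧
        ∀ x ∈ Λ, ∃ i ∈ I, x ∈ Metric.closedBall
          (TopologicalSpace.denseSeq (PoissonTree.Space d) i) (1 / 2) := by
    intro f
    by_cases hf : PoissonTree.IsBoundedLocal f
    · obtain ⟨M, Λ, I, h⟩ := hf.exists_bounds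
      exact ⟨_, fun _ => ⟨M, Λ, I, rfl, h⟩⟩
    · exact ⟨0, fun h => absurd h hf⟩
  choose C hC using hconst
  refine ⟨PoissonTree.halfBallVolume d, PoissonTree.halfBallVolume_pos d, C, ?_⟩
  intro lam hlam Ω _ P _ S hS
  have hV := hS.hasPoissonVoids hlam.le
  refine ⟨hS.isSemigroupWithGenerator hlam.le, hV.isStationary hlam,
    fun μ hμ => hV.stationary_unique hlam hμ, fun f hf t ht η => ?_⟩
  obtain ⟨M, Λ, I, hc, hM, hΛ, hI⟩ := hC f hf
  rw [hc]
  exact hV.abs_semigroup_sub_le hlam hf hM hΛ hI ht η
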